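/- **Hedonic diversity games.** An instance consists of $n\ge 1$ agents $N=\{1,\dots,n\}$ partitioned into nonempty colour classes $D_1,\dots,D_\gamma$, and for every agent $i$ a weak order $\succeq_i$ (a total preorder) on the set of all palettes, where the palette of a nonempty coalition $X\subseteq N$ is $\bigl(|D_c\cap X|/|X|\bigr)_{c=1}^{\gamma}$; agents compare coalitions by comparing their palettes. The instance also contains integers $\sigma,\rho_{\ge1},\rho_{\ge2}\ge 0$. The number $\tau$ of agent types is the number of different preference lists among $\succeq_1,\dots,\succeq_n$. The preferences are given in the oracle model: the explicit input is the colouring together with the three integers, and an oracle answers, for an agent $i$ and nonempty coalitions $C,D$, whether $C\succeq_i D$. An outcome is a partition $\Pi$ of $N$ into nonempty coalitions; $\Pi_i$ is the coalition that contains $i$. Agent $i$ admits an NS-deviation to $C$, where $C\in\Pi$ or $C=\emptyset$, if $C\cup\{i\}\succ_i\Pi_i$; it is an IS-deviation if, in addition, $C\cup\{i\}\succeq_j C$ for every $j\in C$. The outcome is Nash stable (individually stable) if no agent admits an NS-deviation (IS-deviation). The problem HDG-Nash (HDG-Individual) asks whether there is a Nash stable (individually stable) outcome with at most $\rho_{\ge1}$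 coalitions, at most $\rho_{\ge2}$ of them with more than one agent, and all of size at most $\sigma$. **Theorem.** HDG-Nash and HDG-Individual are both $\mathrm{W}[1]$-hard when parameterized by $\gamma+\rho_{\ge1}+\tau$. Here $\mathrm{W}[1]$ is the class of parameterized problems that have a parameterized reduction to Weighted 2-CNF-Satisfiability (is there a satisfying assignment with exactly $k$ true variables? parameter $k$). Hardness means that every problem in $\mathrm{W}[1]$ has a parameterized reduction to the given problem: a map $(x,k)\mapsto I$ that preserves yes- and no-instances, such that the parameter of $I$ is at most $h(k)$ for a computable function $h$, the explicit part of $I$ and its parameter are computable in time $f(k)\cdot|x|^{O(1)}$, and the answer of the oracle of $I$ to a query $q$ is computable from $(x,k,q)$ in time $f(k)\cdot(|x|+|q|)^{O(1)}$, for a computable function $f$. -/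

import Mathlib

/-! ### Machine model: multi-stack machines in structured form, with step counting -/

namespace Machine

/-- A memory: stack number `r` holds the word `s r` over the alphabet `{0, 1}`; the top of the
stack is the head of the list. Every program uses only finitely many of the stacks. -/
abbrev Store : Type := ℕ → List Bool

/-- Programs of a multi-stack machine (equivalently, up to a constant factor in the running time,
of a multi-tape Turing machine: a two-way infinite tape is a pair of stacks). -/
inductive Prog : Type
  | skip : Prog
  | push (r : ℕ) (b : Bool) : Prog
  | pop (r : ℕ) : Prog
  | seq (p q : Prog) : Prog
  /-- three-way branch: stack `r` is empty / has top `0` / has top `1` -/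
  | branch (r : ℕ) (pEmpty pZero pOne : Prog) : Prog
  /-- repeat the body as long as stack `r` is not empty -/
  | loop (r : ℕ) (p : Prog) : Prog

/-- `Exec p s s' t`: started in memory `s`, the program `p` halts in memory `s'` after exactly `t`
steps. Every elementary instruction and every test costs one step. -/
inductive Exec : Prog → Store → Store → ℕ → Prop
  | skip (s : Store) : Exec Prog.skip s s 1
  | push (s : Store) (r : ℕ) (b : Bool) :
      Exec (Prog.push r b) s (Function.update s r (b :: s r)) 1
  | pop (s : Store) (r : ℕ) :
      Exec (Prog.pop r) s (Function.update s r (s r).tail) 1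
  | seq {p q : Prog} {s₁ s₂ s₃ : Store} {t₁ t₂ : ℕ} :
      Exec p s₁ s₂ t₁ → Exec q s₂ s₃ t₂ → Exec (Prog.seq p q) s₁ s₃ (t₁ + t₂)
  | branchEmpty {r : ℕ} {p₀ p₁ p₂ : Prog} {s s' : Store} {t : ℕ} :
      s r = [] → Exec p₀ s s' t → Exec (Prog.branch r p₀ p₁ p₂) s s' (t + 1)
  | branchZero {r : ℕ} {p₀ p₁ p₂ : Prog} {s s' : Store} {t : ℕ} {w : List Bool} :
      s r = false :: w → Exec p₁ s s' t → Exec (Prog.branch r p₀ p₁ p₂) s s' (t + 1)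
  | branchOne {r : ℕ} {p₀ p₁ p₂ : Prog} {s s' : Store} {t : ℕ} {w : List Bool} :
      s r = true :: w → Exec p₂ s s' t → Exec (Prog.branch r p₀ p₁ p₂) s s' (t + 1)
  | loopStop {r : ℕ} {p : Prog} {s : Store} :
      s r = [] → Exec (Prog.loop r p) s s 1
  | loopStep {r : ℕ} {p : Prog} {s₁ s₂ s₃ : Store} {t₁ t₂ : ℕ} :
      s₁ r ≠ [] → Exec p s₁ s₂ t₁ → Exec (Prog.loop r p) s₂ s₃ t₂ →
        Exec (Prog.loop r p) s₁ s₃ (t₁ + t₂ + 1)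

/-- A natural number in unary. -/
def unary (k : ℕ) : List Bool := List.replicate k true

/-- The initial memory: the three given words on the stacks `0`, `1`, `2`, all other stacks
empty. -/
def initStore (a b c : List Bool) : Store
  | 0 => a
  | 1 => b
  | 2 => c
  | _ => []

end Machine

/-! ### Parameterized problems, parameterized reductions, `W[1]` -/

namespace ParamComplexity

open Machine

/-- A parameterized problem: a set of pairs (input word, parameter). -/
abbrev ParamProblem : Type := Set (List Bool × ℕ)

/-- `g` is computable in time `f(k) * |x|^O(1)` for a computable `f`. The machine gets the word
`x` and the parameter `k` (in unary), and leaves the output word on stack `0` and the output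
parameter (in unary) on stack `1`. -/
def FPTComputable (g : List Bool → ℕ → List Bool × ℕ) : Prop :=
  ∃ (p : Prog) (f : ℕ → ℕ) (c : ℕ), Computable f ∧
    ∀ (x : List Bool) (k : ℕ), ∃ (s : Store) (t : ℕ),
      Exec p (initStore x (unary k) []) s t ∧
      s 0 = (g x k).1 ∧ s 1 = unary (g x k).2 ∧
      t ≤ f k * (x.length + 1) ^ c

/-- Parameterized (many-one) reductions between parameterized problems. -/
def ParamReduces (P Q : ParamProblem) : Prop :=
  ∃ g : List Bool → ℕ → List Bool × ℕ,
    FPTComputable g ∧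
    (∃ h : ℕ → ℕ, Computable h ∧ ∀ x k, (g x k).2 ≤ h k) ∧
    ∀ x k, (x, k) ∈ P ↔ g x k ∈ Q

/-- Self-delimiting unary code of a natural number. -/
def encNat (m : ℕ) : List Bool := unary m ++ [false]

/-- A formula in conjunctive normal form over the variables `0, …, numVars - 1`, each clause being
a disjunction of two (possibly equal) literals; a literal is a variable with its sign (`true` for
a positive literal). -/
structure TwoCNF : Type where
  numVars : ℕ
  clauses : List ((Fin numVars × Bool) × (Fin numVars × Bool))

/-- The assignment `a` satisfies every clause. -/
def TwoCNF.SatisfiedBy (φ : TwoCNF) (a : Fin φ.numVars → Bool) : Prop :=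
  ∀ C ∈ φ.clauses, a C.1.1 = C.1.2 ∨ a C.2.1 = C.2.2

/-- The encoding of a formula as a word. -/
def TwoCNF.encode (φ : TwoCNF) : List Bool :=
  encNat φ.numVars ++ φ.clauses.flatMap fun C =>
    (C.1.2 :: encNat C.1.1) ++ (C.2.2 :: encNat C.2.1)

/-- Weighted 2-CNF-Satisfiability, parameterized by the weight `k`: is there a satisfying
assignment that sets exactly `k` variables to true? -/
def weightedTwoCNFSat : ParamProblem :=
  {I | ∃ φ : TwoCNF, I.1 = φ.encode ∧ ∃ a : Fin φ.numVars → Bool,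
    φ.SatisfiedBy a ∧ (Finset.univ.filter fun v => a v = true).card = I.2}

/-- The class `W[1]`: the parameterized problems that have a parameterized reduction to Weighted
2-CNF-Satisfiability. -/
def W1 : Set ParamProblem := {P | ParamReduces P weightedTwoCNFSat}

/-- A parameterized decision problem in the oracle model. An instance consists of an explicit
input word and of an oracle that answers yes/no queries about the instance. -/
structure OracleParamProblem : Type 1 where
  Instance : Type
  /-- the explicit part of the input -/
  input : Instance → List Bool
  /-- the admissible queries to the oracle of an instance, written as words -/
  Query : Instance → Type
  encQuery : ∀ I, Query I → List Bool
  /-- the answers of the oracle -/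
  answer : ∀ I, Query I → Prop
  param : Instance → ℕ
  yes : Set Instance

/-- The explicit part of `g x k`, with its parameter, is computable in time `f(k) * |x|^O(1)`, and
the oracle of `g x k` is given by an algorithm: from `x`, `k` and a query `q` to this oracle, the
answer is computable in time `f(k) * (|x| + |q|)^O(1)`. -/
def OracleFPTComputable (Q : OracleParamProblem) (g : List Bool → ℕ → Q.Instance) : Prop :=
  FPTComputable (fun x k => (Q.input (g x k), Q.param (g x k))) ∧
  ∃ (p : Prog) (f : ℕ → ℕ) (c : ℕ), Computable f ∧
    ∀ (x : List Bool) (k : ℕ) (q : Q.Query (g x k)), ∃ (s : Store) (t : ℕ) (b : Bool),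
      Exec p (initStore x (unary k) (Q.encQuery (g x k) q)) s t ∧
      s 0 = [b] ∧ (b = true ↔ Q.answer (g x k) q) ∧
      t ≤ f k * (x.length + (Q.encQuery (g x k) q).length + 1) ^ c

/-- Parameterized reductions to a problem in the oracle model. -/
def ReducesToOracle (P : ParamProblem) (Q : OracleParamProblem) : Prop :=
  ∃ g : List Bool → ℕ → Q.Instance,
    OracleFPTComputable Q g ∧
    (∃ h : ℕ → ℕ, Computable h ∧ ∀ x k, Q.param (g x k) ≤ h k) ∧
    ∀ x k, (x, k) ∈ P ↔ g x k ∈ Q.yes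

/-- `W[1]`-hardness: every problem in `W[1]` has a parameterized reduction to `Q`. -/
def W1Hard (Q : OracleParamProblem) : Prop := ∀ P ∈ W1, ReducesToOracle P Q

end ParamComplexity

/-! ### Hedonic diversity games -/

namespace HDG

open ParamComplexity

/-- The palette of a set of agents: the fraction of agents of each colour. -/
def palette {n γ : ℕ} (color : Fin n → Fin γ) (X : Finset (Fin n)) : Fin γ → ℚ :=
  fun c => ((X.filter fun a => color a = c).card : ℚ) / (X.card : ℚ)

/-- The set of all palettes (of non-empty coalitions). -/
def Palette {n γ : ℕ} (color : Fin n → Fin γ) : Type :=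
  {p : Fin γ → ℚ // ∃ X : Finset (Fin n), X.Nonempty ∧ palette color X = p}

/-- The palette of a non-empty coalition, as an element of the set of all palettes. -/
def Palette.of {n γ : ℕ} (color : Fin n → Fin γ) (X : Finset (Fin n)) (hX : X.Nonempty) :
    Palette color :=
  ⟨palette color X, X, hX, rfl⟩

/-- An instance of the hedonic diversity game problem: `n` agents, partitioned into `γ` colour
classes; for each agent a weak order (a total preorder, `pref i p q` meaning `p ⪰ᵢ q`) on the set
of all palettes; bounds on the size of a coalition, on the number of coalitions and on the number
of non-trivial coalitions. -/
structure Instance : Type where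
  n : ℕ
  n_pos : 0 < n
  γ : ℕ
  color : Fin n → Fin γ
  color_surjective : Function.Surjective color
  pref : Fin n → Palette color → Palette color → Prop
  pref_total : ∀ i p q, pref i p q ∨ pref i q p
  pref_trans : ∀ i p q r, pref i p q → pref i q r → pref i p r
  maxSize : ℕ
  maxCoalitions : ℕ
  maxNontrivial : ℕ

namespace Instance

variable (G : Instance)

/-- Agent `i` likes coalition `C` at least as much as coalition `D`. -/
def WeakPref (i : Fin G.n) (C D : Finset (Fin G.n)) : Prop :=
  ∃ (hC : C.Nonempty) (hD : D.Nonempty),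
    G.pref i (Palette.of G.color C hC) (Palette.of G.color D hD)

/-- Agent `i` strictly prefers coalition `C` to coalition `D`. -/
def StrictPref (i : Fin G.n) (C D : Finset (Fin G.n)) : Prop :=
  G.WeakPref i C D ∧ ¬ G.WeakPref i D C

/-- An outcome: a partition of the set of agents into (non-empty) coalitions. -/
abbrev Outcome : Type := Finpartition (Finset.univ : Finset (Fin G.n))

variable {G}

/-- Agent `i` admits an NS-deviation to `C`, a coalition of the outcome or the empty one;
`Π.part i` is the coalition of agent `i`. -/
def NSDeviation (P : G.Outcome) (i : Fin G.n) (C : Finset (Fin G.n)) : Prop :=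
  (C ∈ P.parts ∨ C = ∅) ∧ G.StrictPref i (insert i C) (P.part i)

/-- An NS-deviation that every member of the joined coalition accepts. -/
def ISDeviation (P : G.Outcome) (i : Fin G.n) (C : Finset (Fin G.n)) : Prop :=
  NSDeviation P i C ∧ ∀ j ∈ C, G.WeakPref j (insert i C) C

def NashStable (P : G.Outcome) : Prop := ∀ i C, ¬ NSDeviation P i C

def IndividuallyStable (P : G.Outcome) : Prop := ∀ i C, ¬ ISDeviation P i C

/-- The outcome respects the three bounds of the instance. -/
def Admissible (P : G.Outcome) : Prop :=
  P.parts.card ≤ G.maxCoalitions ∧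
  (P.parts.filter fun C => C.card ≠ 1).card ≤ G.maxNontrivial ∧
  ∀ C ∈ P.parts, C.card ≤ G.maxSize

variable (G)

/-- The number of agent types: the number of different preference lists. -/
noncomputable def numTypes : ℕ := (Set.range G.pref).ncard

/-- The explicit part of the input: the number of colours, the three bounds, and the colour of
each agent. -/
def encode : List Bool :=
  encNat G.γ ++ encNat G.maxSize ++ encNat G.maxCoalitions ++ encNat G.maxNontrivial ++
    (List.ofFn fun i => encNat (G.color i)).flatten

/-- A query to the preference oracle: an agent and two non-empty coalitions. -/
structure Query : Type where
  agent : Fin G.n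
  left : Finset (Fin G.n)
  right : Finset (Fin G.n)
  left_nonempty : left.Nonempty
  right_nonempty : right.Nonempty

/-- A query as a word: the agent in unary and the two coalitions as characteristic vectors. -/
def encodeQuery (q : G.Query) : List Bool :=
  encNat q.agent ++ (List.ofFn fun a => decide (a ∈ q.left)) ++
    (List.ofFn fun a => decide (a ∈ q.right))

end Instance

/-- The problem of deciding whether there is an admissible outcome that is stable in the sense
`stable`, in the oracle model, parameterized by (number of colours) + (maximum number of
coalitions, including trivial ones) + (number of agent types). -/
noncomputable def problem (stable : ∀ G : Instance, G.Outcome → Prop) : OracleParamProblem where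
  Instance := Instance
  input := fun G => G.encode
  Query := fun G => G.Query
  encQuery := fun G q => G.encodeQuery q
  answer := fun G q => G.WeakPref q.agent q.left q.right
  param := fun G => G.γ + G.maxCoalitions + G.numTypes
  yes := {G | ∃ P : G.Outcome, Instance.Admissible P ∧ stable G P}

/-- Nash-stable hedonic diversity game, parameterized by `γ + ρ≥1 + τ`. -/
noncomputable def nash : OracleParamProblem := problem fun _ P => Instance.NashStable P

/-- Individually stable hedonic diversity game, parameterized by `γ + ρ≥1 + τ`. -/
noncomputable def individual : OracleParamProblem :=
  problem fun _ P => Instance.IndividuallyStable P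

end HDG

/-!
The preferences of a hedonic diversity game are accessible only through an oracle, and a reduction
may answer the oracle by any fpt-time algorithm. Hence the whole difficulty of an instance can be
hidden in the preferences of a single agent.

Let `x` encode a 2-CNF formula and let `k` be the weight. The game has `k + 1` blocks of
`|x| + 2` agents, one colour per block, and one more agent, `0`, with a colour of its own. Since
`0` is the only agent of its colour, the palette of a coalition that contains `0` determines the
number of its members in each block. These `k + 1` numbers are read as the lengths of the gaps
between the ones of an assignment of weight `k`, written as a word. Agent `0` approves of being
alone and of the coalitions whose numbers encode a satisfying assignment; all other agents are
indifferent. With at most two coalitions, none of which contains all agents or all but one, `0`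
cannot be alone, and leaving a coalition it does not approve of is a deviation that affects nobody
else. So both a Nash stable and an individually stable outcome exist exactly when the formula has a
satisfying assignment of weight `k`. There are only two preference lists, and the oracle evaluates
the formula on the assignment in a single pass over `x`.
-/

namespace Machine

/-! ### Running times up to an upper bound -/

/-- Started in `s`, the program halts in `s'` after at most `T` steps. -/
def Runs (p : Prog) (s s' : Store) (T : ℕ) : Prop := ∃ t ≤ T, Exec p s s' t

section Rules

variable {p q p₀ p₁ p₂ : Prog} {s s' s₁ s₂ s₃ : Store} {T T₁ T₂ : ℕ} {r : ℕ} {b : Bool}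
  {w : List Bool}

theorem Exec.runs {t : ℕ} (h : Exec p s s' t) : Runs p s s' t := ⟨t, le_rfl, h⟩

theorem Runs.mono (h : Runs p s s' T₁) (hT : T₁ ≤ T₂) : Runs p s s' T₂ :=
  let ⟨t, ht, h⟩ := h
  ⟨t, ht.trans hT, h⟩

theorem Runs.congr (h : Runs p s s₁ T) (hs : s₁ = s₂) : Runs p s s₂ T := hs ▸ h

theorem Runs.skip : Runs .skip s s 1 := (Exec.skip s).runs

theorem Runs.seq (h₁ : Runs p s₁ s₂ T₁) (h₂ : Runs q s₂ s₃ T₂) :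
    Runs (.seq p q) s₁ s₃ (T₁ + T₂) :=
  let ⟨_, ht₁, h₁⟩ := h₁
  let ⟨_, ht₂, h₂⟩ := h₂
  ⟨_, Nat.add_le_add ht₁ ht₂, .seq h₁ h₂⟩

theorem Runs.branchEmpty (hr : s r = []) (h : Runs p₀ s s' T) :
    Runs (.branch r p₀ p₁ p₂) s s' (T + 1) :=
  let ⟨_, ht, h⟩ := h
  ⟨_, Nat.succ_le_succ ht, .branchEmpty hr h⟩

theorem Runs.branchZero (hr : s r = false :: w) (h : Runs p₁ s s' T) :
    Runs (.branch r p₀ p₁ p₂) s s' (T + 1) :=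
  let ⟨_, ht, h⟩ := h
  ⟨_, Nat.succ_le_succ ht, .branchZero hr h⟩

theorem Runs.branchOne (hr : s r = true :: w) (h : Runs p₂ s s' T) :
    Runs (.branch r p₀ p₁ p₂) s s' (T + 1) :=
  let ⟨_, ht, h⟩ := h
  ⟨_, Nat.succ_le_succ ht, .branchOne hr h⟩

theorem Runs.loopNil (hr : s r = []) : Runs (.loop r p) s s 1 := (Exec.loopStop hr).runs

theorem Runs.loopCons (hr : s₁ r = b :: w) (h₁ : Runs p s₁ s₂ T₁)
    (h₂ : Runs (.loop r p) s₂ s₃ T₂) : Runs (.loop r p) s₁ s₃ (T₁ + T₂ + 1) :=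
  let ⟨_, ht₁, h₁⟩ := h₁
  let ⟨_, ht₂, h₂⟩ := h₂
  ⟨_, Nat.succ_le_succ (Nat.add_le_add ht₁ ht₂), .loopStep (by simp [hr]) h₁ h₂⟩

theorem Runs.loop_foldl {α : Type*} (S : List Bool → α → Store) (f : α → Bool → α)
    (Inv : α → Prop) (hS : ∀ w a, S w a r = w) (hInv : ∀ a b, Inv a → Inv (f a b))
    (body : ∀ b w a, Inv a → Runs p (S (b :: w) a) (S w (f a b)) T) (w : List Bool) {a : α}
    (ha : Inv a) : Runs (.loop r p) (S w a) (S [] (w.foldl f a)) (w.length * (T + 1) + 1) := by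
  induction w generalizing a with
  | nil => exact (Runs.loopNil (hS [] a)).mono (by simp)
  | cons b w ih =>
    refine (Runs.loopCons (hS _ a) (body b w a ha) (ih (hInv a b ha))).mono ?_
    rw [List.length_cons]
    linarith

theorem Exec.length_le {t : ℕ} (h : Exec p s s' t) (r : ℕ) :
    (s' r).length ≤ (s r).length + t := by
  induction h with
  | push s r' b =>
    by_cases hr : r = r'
    · subst hr; simp
    · simp [Function.update_of_ne hr]
  | pop s r' =>
    by_cases hr : r = r'
    · subst hr; simp; omega
    · simp [Function.update_of_ne hr]
  | _ => omega

end Rules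

/-! ### Memories given by a list of stacks -/

/-- The memory with stack `0` equal to `w`, followed by the stacks of `s`. Concrete memories are
written as `w₀ ∷ w₁ ∷ … ∷ s`, where `s` plays the role of a frame. -/
def Store.cons (w : List Bool) (s : Store) : Store
  | 0 => w
  | r + 1 => s r

notation:67 w:68 "∷" s:67 => Store.cons w s

/-- The memory all of whose stacks are empty. -/
def Store.empty : Store := fun _ => []

/-- Replace the content of stack `r` by `v`. This is `Function.update s r v`, but by recursion on
`r`, so that it computes on memories of the form `w₀ ∷ w₁ ∷ … ∷ s`. -/
def Store.set (s : Store) : ℕ → List Bool → Store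
  | 0, v => v ∷ fun i => s (i + 1)
  | r + 1, v => s 0 ∷ Store.set (fun i => s (i + 1)) r v

theorem Store.set_eq_update (s : Store) (r : ℕ) (v : List Bool) :
    Store.set s r v = Function.update s r v := by
  induction r generalizing s with
  | zero => funext i; cases i <;> simp [Store.set, Store.cons]
  | succ r ih => funext i; cases i <;> simp [Store.set, Store.cons, ih, Function.update_apply]

theorem Store.set_self (s : Store) (r : ℕ) (v : List Bool) : Store.set s r v r = v := by
  rw [Store.set_eq_update, Function.update_self]

theorem initStore_eq (x y z : List Bool) : initStore x y z = x ∷ y ∷ z ∷ Store.empty := by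
  funext i
  match i with
  | 0 | 1 | 2 | _ + 3 => rfl

theorem Runs.push (s : Store) (r : ℕ) (b : Bool) :
    Runs (.push r b) s (Store.set s r (b :: s r)) 1 :=
  ⟨1, le_rfl, Store.set_eq_update s r _ ▸ .push s r b⟩

theorem Runs.pop (s : Store) (r : ℕ) : Runs (.pop r) s (Store.set s r (s r).tail) 1 :=
  ⟨1, le_rfl, Store.set_eq_update s r _ ▸ .pop s r⟩

/-! ### Renumbering the stacks -/

/-- The program with all its stack numbers increased by `d`. -/
def Prog.shift (d : ℕ) : Prog → Prog
  | .skip => .skip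
  | .push r b => .push (r + d) b
  | .pop r => .pop (r + d)
  | .seq p q => .seq (p.shift d) (q.shift d)
  | .branch r p₀ p₁ p₂ => .branch (r + d) (p₀.shift d) (p₁.shift d) (p₂.shift d)
  | .loop r p => .loop (r + d) (p.shift d)

/-- The memory with the stacks of the list `l`, followed by the stacks of `s`. -/
def Store.append (l : List (List Bool)) (s : Store) : Store := l.foldr Store.cons s

theorem Store.append_apply_add (l : List (List Bool)) (s : Store) (r : ℕ) :
    Store.append l s (r + l.length) = s r := by
  induction l with
  | nil => rfl
  | cons _ _ ih => exact ih

theorem Store.update_append_add (l : List (List Bool)) (s : Store) (r : ℕ) (v : List Bool) :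
    Function.update (Store.append l s) (r + l.length) v
      = Store.append l (Function.update s r v) := by
  induction l with
  | nil => rfl
  | cons w l ih =>
    have ih' := congrArg (w ∷ ·) ih
    simp only [← Store.set_eq_update] at ih' ⊢
    exact ih'

theorem Exec.shift {p : Prog} {s s' : Store} {t : ℕ} (h : Exec p s s' t)
    (l : List (List Bool)) :
    Exec (p.shift l.length) (Store.append l s) (Store.append l s') t := by
  have apply_add := Store.append_apply_add l
  induction h with
  | skip s => exact .skip _
  | push s r b =>
    have := Exec.push (Store.append l s) (r + l.length) b
    rwa [Store.update_append_add, apply_add] at this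
  | pop s r =>
    have := Exec.pop (Store.append l s) (r + l.length)
    rwa [Store.update_append_add, apply_add] at this
  | seq _ _ h₁ h₂ => exact .seq h₁ h₂
  | branchEmpty hr _ ih => exact .branchEmpty ((apply_add ..).trans hr) ih
  | branchZero hr _ ih => exact .branchZero ((apply_add ..).trans hr) ih
  | branchOne hr _ ih => exact .branchOne ((apply_add ..).trans hr) ih
  | loopStop hr => exact .loopStop ((apply_add ..).trans hr)
  | loopStep hr _ _ h₁ h₂ => exact .loopStep (by rwa [apply_add]) h₁ h₂

theorem Runs.shift {p : Prog} {s s' : Store} {T : ℕ} (h : Runs p s s' T)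
    (l : List (List Bool)) :
    Runs (p.shift l.length) (Store.append l s) (Store.append l s') T :=
  let ⟨t, ht, h⟩ := h
  ⟨t, ht, h.shift l⟩

/-- A strict upper bound for the numbers of the stacks that occur in the program. -/
def Prog.bound : Prog → ℕ
  | .skip => 0
  | .push r _ => r + 1
  | .pop r => r + 1
  | .seq p q => max p.bound q.bound
  | .branch r p₀ p₁ p₂ => max (r + 1) (max p₀.bound (max p₁.bound p₂.bound))
  | .loop r p => max (r + 1) p.bound

theorem Exec.congr_of_bound_le {p : Prog} {s s' : Store} {t : ℕ} (h : Exec p s s' t) {d : ℕ}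
    (hp : p.bound ≤ d) {u : Store} (hu : ∀ r < d, u r = s r) :
    ∃ u', (∀ r < d, u' r = s' r) ∧ Exec p u u' t := by
  induction h generalizing u with
  | skip s => exact ⟨u, hu, .skip u⟩
  | push s r b =>
    refine ⟨_, fun i hi => ?_, .push u r b⟩
    rw [Function.update_apply, Function.update_apply, hu i hi, hu r hp]
  | pop s r =>
    refine ⟨_, fun i hi => ?_, .pop u r⟩
    rw [Function.update_apply, Function.update_apply, hu i hi, hu r hp]
  | seq _ _ ih₁ ih₂ =>
    obtain ⟨hp₁, hp₂⟩ := max_le_iff.1 hp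
    obtain ⟨u₁, hu₁, h₁⟩ := ih₁ hp₁ hu
    obtain ⟨u₂, hu₂, h₂⟩ := ih₂ hp₂ hu₁
    exact ⟨u₂, hu₂, .seq h₁ h₂⟩
  | branchEmpty hr _ ih =>
    simp only [Prog.bound, max_le_iff] at hp
    obtain ⟨u', hu', h'⟩ := ih hp.2.1 hu
    exact ⟨u', hu', .branchEmpty ((hu _ hp.1).trans hr) h'⟩
  | branchZero hr _ ih =>
    simp only [Prog.bound, max_le_iff] at hp
    obtain ⟨u', hu', h'⟩ := ih hp.2.2.1 hu
    exact ⟨u', hu', .branchZero ((hu _ hp.1).trans hr) h'⟩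
  | branchOne hr _ ih =>
    simp only [Prog.bound, max_le_iff] at hp
    obtain ⟨u', hu', h'⟩ := ih hp.2.2.2 hu
    exact ⟨u', hu', .branchOne ((hu _ hp.1).trans hr) h'⟩
  | loopStop hr => exact ⟨u, hu, .loopStop ((hu _ (max_le_iff.1 hp).1).trans hr)⟩
  | loopStep hr _ _ ih₁ ih₂ =>
    obtain ⟨hr', hp'⟩ := max_le_iff.1 hp
    obtain ⟨u₁, hu₁, h₁⟩ := ih₁ hp' hu
    obtain ⟨u₂, hu₂, h₂⟩ := ih₂ hp hu₁
    exact ⟨u₂, hu₂, .loopStep (by rwa [hu _ hr']) h₁ h₂⟩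

/-! ### Moving and clearing stacks -/

/-- Move the top of stack `a` to stack `b`. -/
def moveTop (a b : ℕ) : Prog :=
  .seq (.branch a .skip (.push b false) (.push b true)) (.pop a)

/-- Move the content of stack `a` to stack `b`, reversing it. -/
def move (a b : ℕ) : Prog := .loop a (moveTop a b)

/-- Move the content of stack `a` both to stack `b` and to stack `c`, reversing it. -/
def moveBoth (a b c : ℕ) : Prog :=
  .loop a (.seq (.branch a .skip (.push b false) (.push b true)) (moveTop a c))

/-- Move the content of stack `a` to stack `b` without reversing it, through the stack `tmp`. -/
def transfer (tmp a b : ℕ) : Prog := .seq (move a tmp) (move tmp b)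

/-- Empty the stacks with numbers less than `n`. -/
def clears : ℕ → Prog
  | 0 => .skip
  | n + 1 => .seq (.loop 0 (.pop 0)) ((clears n).shift 1)

/-- Push the word `w` on stack `r`. -/
def pushWord (r : ℕ) : List Bool → Prog
  | [] => .skip
  | b :: w => .seq (pushWord r w) (.push r b)

theorem runs_moveTop {a b : ℕ} (hab : a ≠ b) {s : Store} {c : Bool} {w : List Bool}
    (h : s a = c :: w) :
    Runs (moveTop a b) s (Store.set (Store.set s b (c :: s b)) a w) 3 := by
  have copy : Runs (.branch a .skip (.push b false) (.push b true)) s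
      (Store.set s b (c :: s b)) 2 := by
    cases c
    · exact .branchZero h (.push s b false)
    · exact .branchOne h (.push s b true)
  refine (copy.seq (.pop _ a)).congr ?_
  simp only [Store.set_eq_update, Function.update_of_ne hab, h, List.tail_cons]

theorem runs_move {a b : ℕ} (hab : a ≠ b) (s : Store) :
    Runs (move a b) s (Store.set (Store.set s b ((s a).reverse ++ s b)) a [])
      (4 * (s a).length + 1) := by
  have body (c : Bool) (w v : List Bool) : Runs (moveTop a b)
      (Store.set (Store.set s b (v ++ s b)) a (c :: w))
      (Store.set (Store.set s b (c :: v ++ s b)) a w) 3 := by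
    refine (runs_moveTop hab (Store.set_self ..)).congr ?_
    funext i
    simp only [Store.set_eq_update, Function.update_apply]
    split_ifs <;> simp_all
  have loop := Runs.loop_foldl (fun w v => Store.set (Store.set s b (v ++ s b)) a w)
    (fun v c => c :: v) (fun _ => True) (fun _ _ => Store.set_self ..) (fun _ _ _ => trivial)
    (fun c w v _ => body c w v) (s a) (a := []) trivial
  simp only [List.foldl_flip_cons_eq_append', List.append_nil, List.nil_append,
    Store.set_eq_update, Function.update_eq_self] at loop ⊢
  exact loop.mono (by linarith)

theorem runs_moveBoth {a b c : ℕ} (hab : a ≠ b) (hac : a ≠ c) (hbc : b ≠ c) (s : Store) :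
    Runs (moveBoth a b c) s
      (Store.set (Store.set (Store.set s b ((s a).reverse ++ s b)) c ((s a).reverse ++ s c)) a [])
      (6 * (s a).length + 1) := by
  let S (w v : List Bool) : Store :=
    Store.set (Store.set (Store.set s b (v ++ s b)) c (v ++ s c)) a w
  have hS (w v) : S w v a = w := Store.set_self ..
  have body (x : Bool) (w v : List Bool) :
      Runs (.seq (.branch a .skip (.push b false) (.push b true)) (moveTop a c))
        (S (x :: w) v) (S w (x :: v)) 5 := by
    have copy : Runs (.branch a .skip (.push b false) (.push b true)) (S (x :: w) v)
        (Store.set (S (x :: w) v) b (x :: S (x :: w) v b)) 2 := by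
      cases x
      · exact .branchZero (hS ..) (.push _ b false)
      · exact .branchOne (hS ..) (.push _ b true)
    refine (copy.seq (runs_moveTop hac (c := x) (w := w) ?_)).congr ?_
    · simp [S, Store.set_eq_update, hab]
    · funext i
      simp only [S, Store.set_eq_update, Function.update_apply]
      split_ifs <;> simp_all
  have loop := Runs.loop_foldl S (fun v c => c :: v) (fun _ => True) hS (fun _ _ _ => trivial)
    (fun c w v _ => body c w v) (s a) (a := []) trivial
  simp only [S, List.foldl_flip_cons_eq_append', List.append_nil, List.nil_append,
    Store.set_eq_update, Function.update_eq_self] at loop ⊢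
  exact loop.mono (by linarith)

theorem runs_transfer {tmp a b : ℕ} (ha : a ≠ tmp) (hb : tmp ≠ b) (hab : a ≠ b) {s : Store}
    (htmp : s tmp = []) (hsb : s b = []) :
    Runs (transfer tmp a b) s (Store.set (Store.set s b (s a)) a []) (8 * (s a).length + 2) := by
  refine (((runs_move ha s).seq (runs_move hb _)).mono ?_).congr ?_
  · simp [Store.set_eq_update, ha.symm, htmp]
    omega
  · funext i
    simp only [Store.set_eq_update, Function.update_apply]
    split_ifs <;> simp_all

theorem runs_clears (l : List (List Bool)) (s : Store) :
    Runs (clears l.length) (Store.append l s) (Store.append (l.map fun _ => []) s)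
      (2 * (l.map List.length).sum + l.length + 1) := by
  induction l with
  | nil => exact Runs.skip
  | cons w l ih =>
    have clear_head : Runs (.loop 0 (.pop 0)) (w ∷ Store.append l s) ([] ∷ Store.append l s)
        (2 * w.length + 1) := by
      induction w with
      | nil => exact .loopNil rfl
      | cons b w ihw =>
        exact (Runs.loopCons rfl (.pop _ 0) ihw).mono (by rw [List.length_cons]; omega)
    refine (clear_head.seq (ih.shift [[]])).mono ?_
    simp only [List.map_cons, List.sum_cons, List.length_cons]
    omega

theorem runs_pushWord (r : ℕ) (w : List Bool) (s : Store) :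
    Runs (pushWord r w) s (Store.set s r (w ++ s r)) (w.length + 1) := by
  induction w with
  | nil => exact Runs.skip.congr (by simp [Store.set_eq_update])
  | cons b w ih =>
    refine ((ih.seq (.push _ r b)).mono (by simp)).congr ?_
    simp only [Store.set_eq_update, Function.update_self, Function.update_idem, List.cons_append]

theorem Store.set_append_add (l : List (List Bool)) (s : Store) (r : ℕ) (v : List Bool) :
    Store.set (Store.append l s) (r + l.length) v = Store.append l (Store.set s r v) := by
  simp only [Store.set_eq_update, Store.update_append_add]

theorem Store.append_replicate_nil_apply (s : Store) {n r : ℕ} (h : r < n) :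
    Store.append (List.replicate n []) s r = [] := by
  induction n generalizing r with
  | zero => omega
  | succ n ih =>
    cases r with
    | zero => rfl
    | succ r => exact ih (Nat.lt_of_succ_lt_succ h)

theorem Store.nil_cons_empty : [] ∷ Store.empty = Store.empty := by
  funext i
  cases i <;> rfl

theorem Store.append_replicate_empty (n : ℕ) :
    Store.append (List.replicate n []) Store.empty = Store.empty := by
  induction n with
  | zero => rfl
  | succ n ih => exact (congrArg ([] ∷ ·) ih).trans Store.nil_cons_empty

/-- Move the stacks `0` and `1` to the stacks `d + 4` and `d + 5`. -/
def saveInput (d : ℕ) : Prog := .seq (transfer 3 0 (d + 4)) (transfer 3 1 (d + 5))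

/-- Move the stacks `d + 4` and `d + 5` to the stacks `0` and `1`. -/
def restoreOutput (d : ℕ) : Prog := .seq (transfer 3 (d + 4) 0) (transfer 3 (d + 5) 1)

/-- Run `p` on the words on stacks `0` and `1`, and then `q` on its output, with stack `2` as it
was at the beginning. All stacks of `p` are moved beyond those of `q`, so that `q` ignores what
`p` leaves behind. -/
def comp (p q : Prog) : Prog :=
  .seq (saveInput q.bound) <| .seq (p.shift (q.bound + 4)) <| .seq (restoreOutput q.bound) q

section Comp

/-- The first `d + 4` stacks while the stacks of the first program of `comp` are in use. -/
def lowStacks (d : ℕ) (x y z : List Bool) : List (List Bool) :=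
  [x, y, z, []] ++ List.replicate d []

variable (d : ℕ) (x y z : List Bool) (s : Store)

theorem length_lowStacks : (lowStacks d x y z).length = d + 4 := by simp [lowStacks]

theorem Store.append_lowStacks_apply (r : ℕ) :
    Store.append (lowStacks d x y z) s (d + 4 + r) = s r := by
  rw [← length_lowStacks d x y z, add_comm, Store.append_apply_add]

theorem Store.set_append_lowStacks (r : ℕ) (v : List Bool) :
    Store.set (Store.append (lowStacks d x y z) s) (d + 4 + r) v
      = Store.append (lowStacks d x y z) (Store.set s r v) := by
  rw [← length_lowStacks d x y z, add_comm, Store.set_append_add]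

theorem runs_saveInput :
    Runs (saveInput d) (initStore x y z)
      (Store.append (lowStacks d [] [] z) (initStore x y []))
      (8 * (x.length + y.length) + 4) := by
  have start : initStore x y z
      = Store.append (lowStacks d x y z) ([] ∷ [] ∷ [] ∷ Store.empty) := by
    change _ = x ∷ y ∷ z ∷ [] ∷ Store.append (List.replicate d []) _
    simp only [initStore_eq, Store.nil_cons_empty, Store.append_replicate_empty]
  have save_x : Runs (transfer 3 0 (d + 4))
      (Store.append (lowStacks d x y z) ([] ∷ [] ∷ [] ∷ Store.empty))
      (Store.append (lowStacks d [] y z) (x ∷ [] ∷ [] ∷ Store.empty)) (8 * x.length + 2) :=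
    (runs_transfer (by omega) (by omega) (by omega) rfl
      (Store.append_lowStacks_apply _ _ _ _ _ 0)).congr
      (congrArg (Store.set · 0 []) (Store.set_append_lowStacks d x y z _ 0 x))
  have save_y : Runs (transfer 3 1 (d + 5))
      (Store.append (lowStacks d [] y z) (x ∷ [] ∷ [] ∷ Store.empty))
      (Store.append (lowStacks d [] [] z) (x ∷ y ∷ [] ∷ Store.empty)) (8 * y.length + 2) :=
    (runs_transfer (by omega) (by omega) (by omega) rfl
      (Store.append_lowStacks_apply _ _ _ _ _ 1)).congr
      (congrArg (Store.set · 1 []) (Store.set_append_lowStacks d [] y z _ 1 y))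
  rw [start, initStore_eq]
  exact (save_x.seq save_y).mono (by omega)

theorem runs_restoreOutput :
    Runs (restoreOutput d) (Store.append (lowStacks d [] [] z) s)
      (Store.append (lowStacks d (s 0) (s 1) z) (Store.set (Store.set s 0 []) 1 []))
      (8 * ((s 0).length + (s 1).length) + 4) := by
  have restore₀ := runs_transfer (tmp := 3) (a := d + 4) (b := 0) (by omega) (by omega) (by omega)
    (s := Store.append (lowStacks d [] [] z) s) rfl rfl
  rw [show Store.append (lowStacks d [] [] z) s (d + 4) = s 0 from
    Store.append_lowStacks_apply _ _ _ _ _ 0] at restore₀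
  replace restore₀ := restore₀.congr (Store.set_append_lowStacks d (s 0) [] z s 0 [])
  have restore₁ := runs_transfer (tmp := 3) (a := d + 5) (b := 1) (by omega) (by omega) (by omega)
    (s := Store.append (lowStacks d (s 0) [] z) (Store.set s 0 [])) rfl rfl
  rw [show Store.append (lowStacks d (s 0) [] z) (Store.set s 0 []) (d + 5) = s 1 from
    Store.append_lowStacks_apply _ _ _ _ _ 1] at restore₁
  replace restore₁ := restore₁.congr (Store.set_append_lowStacks d (s 0) (s 1) z _ 1 [])
  exact (restore₀.seq restore₁).mono (by omega)

theorem Store.append_lowStacks_eq_initStore {r : ℕ} (hr : r < d + 4) :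
    Store.append (lowStacks d x y z) s r = initStore x y z r :=
  match r, hr with
  | 0, _ | 1, _ | 2, _ | 3, _ => rfl
  | _ + 4, hr => Store.append_replicate_nil_apply _ (Nat.lt_of_add_lt_add_right hr)

end Comp

theorem exec_comp {p q : Prog} {x y z : List Bool} {s u : Store} {t₁ t₂ : ℕ}
    (hp : Exec p (initStore x y []) s t₁) (hq : Exec q (initStore (s 0) (s 1) z) u t₂) :
    ∃ u' t, Exec (comp p q) (initStore x y z) u' t ∧ u' 0 = u 0 ∧ u' 1 = u 1 ∧
      t ≤ t₁ + t₂ + 8 * (x.length + y.length + (s 0).length + (s 1).length) + 8 := by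
  have run_p := hp.shift (lowStacks q.bound [] [] z)
  rw [length_lowStacks] at run_p
  obtain ⟨u', hu', run_q⟩ := hq.congr_of_bound_le (le_add_right le_rfl : q.bound ≤ q.bound + 4)
    fun r hr => Store.append_lowStacks_eq_initStore q.bound (s 0) (s 1) z
      (Store.set (Store.set s 0 []) 1 []) hr
  obtain ⟨t, ht, h⟩ := (runs_saveInput q.bound x y z).seq <|
    run_p.runs.seq <|
    (runs_restoreOutput q.bound z s).seq run_q.runs
  exact ⟨u', t, h, hu' 0 (by omega), hu' 1 (by omega), by omega⟩

end Machine

namespace ParamComplexity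

open Machine

/-! ### Composition of reductions -/

theorem computable_pow_const {f : ℕ → ℕ} (hf : Computable f) (c : ℕ) :
    Computable fun k => f k ^ c := by
  induction c with
  | zero => simpa using Computable.const 1
  | succ c ih => simpa only [pow_succ] using Primrec.nat_mul.to_comp.comp ih hf

theorem computable_sum_range {f : ℕ → ℕ} (hf : Computable f) :
    Computable fun n => ∑ i ∈ Finset.range n, f i := by
  have step : Computable₂ fun (_ : ℕ) (p : ℕ × ℕ) => p.2 + f p.1 :=
    Primrec.nat_add.to_comp.comp (Computable.snd.comp Computable.snd)
      (hf.comp (Computable.fst.comp Computable.snd))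
  refine (Computable.nat_rec Computable.id (Computable.const 0) step).of_eq fun n => ?_
  induction n with
  | zero => rfl
  | succ n ih => rw [Finset.sum_range_succ, ← ih]; rfl

/-- The bound `f k * n ^ c` for the time of a two-stage computation on a word of length `n`, whose
first stage takes time `f₁ k * n ^ c₁` and whose second stage takes time `f₂ k' * n' ^ c₂` on the
output of the first one, with parameter `k' ≤ h k`. As `f₂` need not be monotone, its values up to
`h k` are summed. -/
def compTime (f₁ f₂ h : ℕ → ℕ) (c₂ : ℕ) (k : ℕ) : ℕ :=
  (f₁ k + 1) ^ c₂ * ∑ j ∈ Finset.range (h k + 1), f₂ j + (9 * (f₁ k + 1) + 8 * (k + h k) + 16)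

theorem computable_compTime {f₁ f₂ h : ℕ → ℕ} (hf₁ : Computable f₁) (hf₂ : Computable f₂)
    (hh : Computable h) (c₂ : ℕ) : Computable (compTime f₁ f₂ h c₂) := by
  have add {f g : ℕ → ℕ} (hf : Computable f) (hg : Computable g) :
      Computable fun k => f k + g k := Primrec.nat_add.to_comp.comp hf hg
  have mul {f g : ℕ → ℕ} (hf : Computable f) (hg : Computable g) :
      Computable fun k => f k * g k := Primrec.nat_mul.to_comp.comp hf hg
  have const (c : ℕ) : Computable fun _ : ℕ => c := Computable.const c
  exact add
    (mul (computable_pow_const (add hf₁ (const 1)) c₂)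
      ((computable_sum_range hf₂).comp (add hh (const 1))))
    (add (add (mul (const 9) (add hf₁ (const 1))) (mul (const 8) (add Computable.id hh)))
      (const 16))

theorem le_compTime_mul_pow {f₁ f₂ h : ℕ → ℕ} {c₁ c₂ k k' n n' m t₁ t₂ : ℕ} (hk : k' ≤ h k)
    (ht₁ : t₁ ≤ f₁ k * (n + 1) ^ c₁) (hn : n' ≤ n + t₁) (ht₂ : t₂ ≤ f₂ k' * (n' + m + 1) ^ c₂) :
    t₁ + t₂ + 8 * (n + k + n' + k') + 8 ≤
      compTime f₁ f₂ h c₂ k * (n + m + 1) ^ ((c₁ + 1) * (c₂ + 1)) := by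
  obtain ⟨N, hN⟩ : ∃ N, N = n + m + 1 := ⟨_, rfl⟩
  set c := (c₁ + 1) * (c₂ + 1) with hc
  have pow_le {d e : ℕ} (h : d ≤ e) : N ^ d ≤ N ^ e := Nat.pow_le_pow_right (by omega) h
  have le_self_pow {e : ℕ} (h : 1 ≤ e) : N ≤ N ^ e := Nat.le_self_pow (by omega) N
  have t₁_le {e : ℕ} (h : c₁ ≤ e) : t₁ ≤ f₁ k * N ^ e :=
    ht₁.trans (Nat.mul_le_mul_left _ ((Nat.pow_le_pow_left (by omega) _).trans (pow_le h)))
  have mid_le : n' + m + 1 ≤ (f₁ k + 1) * N ^ (c₁ + 1) := by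
    have := t₁_le (Nat.le_add_right c₁ 1)
    have := le_self_pow (Nat.le_add_left 1 c₁)
    rw [add_one_mul]
    omega
  have f₂_le : f₂ k' ≤ ∑ j ∈ Finset.range (h k + 1), f₂ j :=
    Finset.single_le_sum (fun _ _ => Nat.zero_le _) (Finset.mem_range.2 (by omega))
  have t₂_le : t₂ ≤ (f₁ k + 1) ^ c₂ * (∑ j ∈ Finset.range (h k + 1), f₂ j) * N ^ c :=
    calc t₂ ≤ f₂ k' * (n' + m + 1) ^ c₂ := ht₂
      _ ≤ (∑ j ∈ Finset.range (h k + 1), f₂ j) * ((f₁ k + 1) * N ^ (c₁ + 1)) ^ c₂ := by gcongr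
      _ = (f₁ k + 1) ^ c₂ * (∑ j ∈ Finset.range (h k + 1), f₂ j) * N ^ ((c₁ + 1) * c₂) := by
        rw [mul_pow, ← pow_mul]; ring
      _ ≤ _ := Nat.mul_le_mul_left _ (pow_le (Nat.mul_le_mul_left _ (Nat.le_succ _)))
  have t₁_le' := t₁_le (e := c) (by nlinarith)
  have N_le := le_self_pow (e := c) (by nlinarith)
  have k_le : k ≤ k * N ^ c := Nat.le_mul_of_pos_right _ (by omega)
  have h_le : h k ≤ h k * N ^ c := Nat.le_mul_of_pos_right _ (by omega)
  rw [compTime, ← hN]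
  linarith

theorem ParamReduces.trans_reducesToOracle {P R : ParamProblem} {Q : OracleParamProblem}
    (hPR : ParamReduces P R) (hRQ : ReducesToOracle R Q) : ReducesToOracle P Q := by
  obtain ⟨g₁, ⟨p, f₁, c₁, hf₁, hp⟩, ⟨h₁, hh₁, hg₁⟩, hPR⟩ := hPR
  obtain ⟨g₂, ⟨⟨q, f₂, c₂, hf₂, hq⟩, p', f₃, c₃, hf₃, hp'⟩, ⟨h₂, hh₂, hg₂⟩, hRQ⟩ := hRQ
  have length_le {x k s t} (h : Exec p (initStore x (unary k) []) s t)
      (hs : s 0 = (g₁ x k).1) : (g₁ x k).1.length ≤ x.length + t := hs ▸ h.length_le 0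
  refine ⟨fun x k => g₂ (g₁ x k).1 (g₁ x k).2, ⟨?_, ?_⟩, ?_, ?_⟩
  · refine ⟨comp p q, compTime f₁ f₂ h₁ c₂, (c₁ + 1) * (c₂ + 1),
      computable_compTime hf₁ hf₂ hh₁ c₂, fun x k => ?_⟩
    obtain ⟨s, t₁, hs, hs0, hs1, ht₁⟩ := hp x k
    obtain ⟨u, t₂, hu, hu0, hu1, ht₂⟩ := hq (g₁ x k).1 (g₁ x k).2
    obtain ⟨u', t, hu', h0, h1, ht⟩ := exec_comp hs (by rwa [hs0, hs1])
    refine ⟨u', t, hu', h0.trans hu0, h1.trans hu1, ht.trans ?_⟩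
    simpa [hs0, hs1, unary] using
      le_compTime_mul_pow (m := 0) (hg₁ x k) ht₁ (length_le hs hs0) ht₂
  · refine ⟨comp p p', compTime f₁ f₃ h₁ c₃, (c₁ + 1) * (c₃ + 1),
      computable_compTime hf₁ hf₃ hh₁ c₃, fun x k z => ?_⟩
    obtain ⟨s, t₁, hs, hs0, hs1, ht₁⟩ := hp x k
    obtain ⟨u, t₂, b, hu, hu0, hb, ht₂⟩ := hp' (g₁ x k).1 (g₁ x k).2 z
    obtain ⟨u', t, hu', h0, -, ht⟩ := exec_comp hs (by rwa [hs0, hs1])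
    refine ⟨u', t, b, hu', h0.trans hu0, hb, ht.trans ?_⟩
    simpa [hs0, hs1, unary] using
      le_compTime_mul_pow (hg₁ x k) ht₁ (length_le hs hs0) ht₂
  · refine ⟨fun k => ∑ j ∈ Finset.range (h₁ k + 1), h₂ j, ?_, fun x k => ?_⟩
    · exact (computable_sum_range hh₂).comp (Primrec.succ.to_comp.comp hh₁)
    · exact (hg₂ _ _).trans (Finset.single_le_sum (f := h₂) (fun _ _ => Nat.zero_le _)
        (Finset.mem_range.2 (Nat.lt_succ_of_le (hg₁ x k))))
  · exact fun x k => (hPR x k).trans (hRQ _ _)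

theorem w1Hard_of_reducesToOracle {Q : OracleParamProblem}
    (h : ReducesToOracle weightedTwoCNFSat Q) : W1Hard Q :=
  fun _ hP => ParamReduces.trans_reducesToOracle hP h

/-! ### Checking an assignment by a single pass over a formula -/

/-- The position of `EvalState.step` in the encoding of a formula: in the number of variables,
before a literal, in the variable of a literal with sign `c`, or anywhere after an error. -/
inductive EvalMode : Type
  | header
  | sign
  | var (c : Bool)
  | failed

/-- The state of the evaluation of a formula under an assignment, which is given as the word of
its values. Reading a variable moves a head along this word: `rest` is the part from the head on
and `done` the reversed part before it. The value of the first literal of a clause is kept in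
`pending` until the second one is known. -/
structure EvalState : Type where
  rest : List Bool
  done : List Bool
  mode : EvalMode
  pending : Option Bool

namespace EvalState

/-- The state before a literal. -/
def between (w : List Bool) (p : Option Bool) : EvalState := ⟨w, [], .sign, p⟩

/-- The state after an error, with the word of values `w`. -/
def error (w : List Bool) (p : Option Bool) : EvalState := ⟨w, [], .failed, p⟩

/-- Move the head one symbol to the right, unless it is at the end of the word. -/
def advance : EvalState → EvalState
  | ⟨b :: rest, done, mode, p⟩ => ⟨rest, b :: done, mode, p⟩
  | ⟨[], done, mode, p⟩ => ⟨[], done, mode, p⟩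

/-- The state after a literal with value `v`. -/
def record (w : List Bool) : Option Bool → Bool → EvalState
  | none, v => between w (some v)
  | some u, v => if u || v then between w none else error w none

/-- Read one symbol of a formula. The word of values has to end with an additional `0`: a formula
with `n` variables is evaluated on words of length `n + 1`. -/
def step : EvalState → Bool → EvalState
  | ⟨r, d, .header, p⟩, true => advance ⟨r, d, .header, p⟩
  | ⟨[false], d, .header, p⟩, false => between (d.reverse ++ [false]) p
  | ⟨r, d, .header, p⟩, false => error (d.reverse ++ r) p
  | ⟨r, d, .sign, p⟩, c => ⟨r, d, .var c, p⟩
  | ⟨r, d, .var c, p⟩, true => advance ⟨r, d, .var c, p⟩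
  | ⟨b :: b' :: r, d, .var c, p⟩, false => record (d.reverse ++ b :: b' :: r) p (b == c)
  | ⟨r, d, .var _, p⟩, false => error (d.reverse ++ r) p
  | ⟨r, d, .failed, p⟩, _ => ⟨r, d, .failed, p⟩

/-- Reading the word `x` from the state `σ` ends between two clauses, without an error. -/
def Accepts (σ : EvalState) (x : List Bool) : Prop :=
  (x.foldl step σ).mode = .sign ∧ (x.foldl step σ).pending = none

theorem accepts_append {σ : EvalState} {x y : List Bool} :
    σ.Accepts (x ++ y) ↔ (x.foldl step σ).Accepts y := by
  simp only [Accepts, List.foldl_append]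

theorem not_accepts_of_failed (x : List Bool) {σ : EvalState} (h : σ.mode = .failed) :
    ¬ σ.Accepts x := by
  have stays : (x.foldl step σ).mode = .failed := by
    induction x generalizing σ with
    | nil => exact h
    | cons b x ih =>
      obtain ⟨r, d, m, p⟩ := σ
      cases h
      exact ih rfl
  exact fun h => by simp [Accepts, stays] at h

theorem foldl_step_unary (m : ℕ) (r d : List Bool) (mode : EvalMode) (p : Option Bool)
    (hmode : mode = .header ∨ ∃ c, mode = .var c) :
    (unary m).foldl step ⟨r, d, mode, p⟩
      = ⟨r.drop m, (r.take m).reverse ++ d, mode, p⟩ := by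
  have step_one (r d) : step ⟨r, d, mode, p⟩ true = advance ⟨r, d, mode, p⟩ := by
    obtain rfl | ⟨c, rfl⟩ := hmode <;> cases r <;> rfl
  induction m generalizing r d with
  | zero => rfl
  | succ m ih =>
    change (unary m).foldl step (step ⟨r, d, mode, p⟩ true) = _
    rw [step_one]
    cases r with
    | nil => exact (ih [] d).trans (by simp)
    | cons b r => exact (ih r (b :: d)).trans (by simp)

theorem foldl_step_literal (w : List Bool) (p : Option Bool) (c : Bool) (v : ℕ) :
    (c :: encNat v).foldl step (between w p)
      = if h : v + 1 < w.length then record w p (w[v] == c) else error w p := by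
  have read : (c :: encNat v).foldl step (between w p)
      = step ⟨w.drop v, (w.take v).reverse, .var c, p⟩ false := by
    rw [encNat, List.foldl_cons, List.foldl_append]
    change step ((unary v).foldl step ⟨w, [], .var c, p⟩) false = _
    rw [foldl_step_unary _ _ _ _ _ (.inr ⟨c, rfl⟩), List.append_nil]
  have rewind : (w.take v).reverse.reverse ++ w.drop v = w := by simp
  rw [read]
  split_ifs with h
  · have drop_eq : w.drop v = w[v] :: w[v + 1] :: w.drop (v + 2) := by
      rw [List.drop_eq_getElem_cons (by omega), List.drop_eq_getElem_cons h]
    rw [drop_eq] at rewind ⊢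
    exact congrArg (fun w' => record w' p (w[v] == c)) rewind
  · have short : (w.drop v).length ≤ 1 := by rw [List.length_drop]; omega
    match hd : w.drop v, short with
    | [], _ | [_], _ =>
      rw [hd] at rewind
      exact congrArg (fun w' => error w' p) rewind

theorem foldl_step_header (w : List Bool) (n : ℕ) :
    (encNat n).foldl step ⟨w, [], .header, none⟩
      = if w.drop n = [false] then between w none else error w none := by
  have read : (encNat n).foldl step ⟨w, [], .header, none⟩
      = step ⟨w.drop n, (w.take n).reverse, .header, none⟩ false := by
    rw [encNat, List.foldl_append, foldl_step_unary _ _ _ _ _ (.inl rfl), List.append_nil]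
    rfl
  have rewind : (w.take n).reverse.reverse ++ w.drop n = w := by simp
  rw [read]
  split_ifs with h
  · rw [h] at rewind ⊢
    exact congrArg (fun w' => between w' none) rewind
  · match hd : w.drop n, h with
    | [], _ | [true], _ | true :: _ :: _, _ | false :: _ :: _, _ =>
      rw [hd] at rewind
      exact congrArg (fun w' => error w' none) rewind

theorem eq_unary_or_eq_encNat_append (x : List Bool) :
    (∃ m, x = unary m) ∨ ∃ m y, x = encNat m ++ y := by
  induction x with
  | nil => exact .inl ⟨0, rfl⟩
  | cons b x ih =>
    cases b with
    | false => exact .inr ⟨0, x, rfl⟩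
    | true =>
      obtain ⟨m, rfl⟩ | ⟨m, y, rfl⟩ := ih
      · exact .inl ⟨m + 1, rfl⟩
      · exact .inr ⟨m + 1, y, rfl⟩

variable {n : ℕ} (a : Fin n → Bool)

theorem accepts_between_iff_exists_literal {p : Option Bool} {x : List Bool}
    (h : x ≠ [] ∨ p ≠ none) :
    (between (List.ofFn a ++ [false]) p).Accepts x ↔
      ∃ (v : Fin n) (c : Bool) (y : List Bool), x = c :: encNat v ++ y ∧
        (record (List.ofFn a ++ [false]) p (a v == c)).Accepts y := by
  have literal (v c y) : (between (List.ofFn a ++ [false]) p).Accepts (c :: encNat v ++ y) ↔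
      ∃ hv : v < n, (record (List.ofFn a ++ [false]) p (a ⟨v, hv⟩ == c)).Accepts y := by
    rw [accepts_append, foldl_step_literal]
    by_cases hv : v < n
    · simp [hv, List.getElem_append_left]
    · simpa [hv] using not_accepts_of_failed y rfl
  refine ⟨fun hx => ?_, ?_⟩
  · cases x with
    | nil => exact absurd hx.2 (h.resolve_left (· rfl))
    | cons c x =>
      obtain ⟨m, rfl⟩ | ⟨m, y, rfl⟩ := eq_unary_or_eq_encNat_append x
      · have hx' := hx.1
        rw [List.foldl_cons] at hx'
        change ((unary m).foldl step ⟨_, _, .var c, _⟩).mode = _ at hx'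
        rw [foldl_step_unary _ _ _ _ _ (.inr ⟨c, rfl⟩)] at hx'
        cases hx'
      · obtain ⟨hm, hy⟩ := (literal m c y).1 hx
        exact ⟨⟨m, hm⟩, c, y, rfl, hy⟩
  · rintro ⟨v, c, y, rfl, hy⟩
    exact (literal v c y).2 ⟨v.2, hy⟩

theorem accepts_between_iff_exists_clause {x : List Bool} (hx : x ≠ []) :
    (between (List.ofFn a ++ [false]) none).Accepts x ↔
      ∃ (C : (Fin n × Bool) × (Fin n × Bool)) (y : List Bool),
        x = (C.1.2 :: encNat C.1.1) ++ (C.2.2 :: encNat C.2.1) ++ y ∧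
        (a C.1.1 = C.1.2 ∨ a C.2.1 = C.2.2) ∧
        (between (List.ofFn a ++ [false]) none).Accepts y := by
  have second {u v : Bool} {y : List Bool} :
      (record (List.ofFn a ++ [false]) (some u) v).Accepts y ↔
        (u = true ∨ v = true) ∧ (between (List.ofFn a ++ [false]) none).Accepts y := by
    rw [← Bool.or_eq_true, record]
    cases u || v
    · simpa using not_accepts_of_failed (σ := error _ _) y rfl
    · simp
  have first (v : Bool) : record (List.ofFn a ++ [false]) none v
      = between (List.ofFn a ++ [false]) (some v) := rfl
  rw [accepts_between_iff_exists_literal a (.inl hx)]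
  simp only [first, accepts_between_iff_exists_literal a (.inr (Option.some_ne_none _)), second,
    beq_iff_eq]
  constructor
  · rintro ⟨v, c, _, rfl, v', c', y, rfl, h⟩
    exact ⟨((v, c), (v', c')), y, (List.append_assoc ..).symm, h⟩
  · rintro ⟨⟨⟨v, c⟩, ⟨v', c'⟩⟩, y, rfl, h⟩
    exact ⟨v, c, _, List.append_assoc .., v', c', y, rfl, h⟩

theorem accepts_between_iff_exists_clauses (x : List Bool) :
    (between (List.ofFn a ++ [false]) none).Accepts x ↔
      ∃ l : List ((Fin n × Bool) × (Fin n × Bool)),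
        TwoCNF.SatisfiedBy ⟨n, l⟩ a ∧ encNat n ++ x = TwoCNF.encode ⟨n, l⟩ := by
  simp only [TwoCNF.encode, List.append_cancel_left_eq]
  constructor
  · intro hx
    induction hl : x.length using Nat.strong_induction_on generalizing x with
    | _ m ih =>
      by_cases hnil : x = []
      · exact ⟨[], by simp [TwoCNF.SatisfiedBy], hnil⟩
      · obtain ⟨C, y, rfl, hC, hy⟩ := (accepts_between_iff_exists_clause a hnil).1 hx
        obtain ⟨l, sat, rfl⟩ := ih y.length (by simp at hl; omega) y hy rfl
        exact ⟨C :: l, List.forall_mem_cons.2 ⟨hC, sat⟩, rfl⟩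
  · rintro ⟨l, hl, rfl⟩
    induction l with
    | nil => exact ⟨rfl, rfl⟩
    | cons C l ih =>
      obtain ⟨hC, hl⟩ := List.forall_mem_cons.1 hl
      exact (accepts_between_iff_exists_clause a (by simp)).2 ⟨C, _, rfl, hC, ih hl⟩

end EvalState

/-- Evaluating the formula `x` on the word of values `w`, which has to end with an additional `0`,
succeeds. -/
def Evaluates (x w : List Bool) : Prop := (⟨w, [], .header, none⟩ : EvalState).Accepts x

theorem evaluates_iff {x w : List Bool} :
    Evaluates x w ↔ ∃ (φ : TwoCNF) (a : Fin φ.numVars → Bool),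
      x = φ.encode ∧ φ.SatisfiedBy a ∧ w = List.ofFn a ++ [false] := by
  constructor
  · intro h
    obtain ⟨m, rfl⟩ | ⟨n, y, rfl⟩ := EvalState.eq_unary_or_eq_encNat_append x
    · cases (EvalState.foldl_step_unary m w [] .header none (.inl rfl) ▸ h.1 :)
    · rw [Evaluates, EvalState.accepts_append, EvalState.foldl_step_header] at h
      split_ifs at h with hw
      · have hlen : (w.take n).length = n := by
          have := congrArg List.length hw
          simp only [List.length_drop, List.length_singleton, List.length_take] at this ⊢
          omega
        obtain ⟨a, ha⟩ : ∃ a : Fin n → Bool, w.take n = List.ofFn a := by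
          generalize w.take n = w' at hlen
          subst hlen
          exact ⟨w'.get, (List.ofFn_get w').symm⟩
        have hwa : w = List.ofFn a ++ [false] := by rw [← ha, ← hw, List.take_append_drop]
        rw [hwa, EvalState.accepts_between_iff_exists_clauses] at h
        obtain ⟨l, hl, hx⟩ := h
        exact ⟨⟨n, l⟩, a, hx, hl, hwa⟩
      · exact absurd h (EvalState.not_accepts_of_failed y rfl)
  · rintro ⟨⟨n, l⟩, a, rfl, h, rfl⟩
    rw [Evaluates, TwoCNF.encode, EvalState.accepts_append, EvalState.foldl_step_header]
    rw [if_pos (by simp), EvalState.accepts_between_iff_exists_clauses]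
    exact ⟨l, h, rfl⟩

/-! ### Words as lists of gaps -/

/-- The word whose blocks of consecutive zeros, separated by single ones, have the lengths
`m, m₁, m₂, …` from right to left, where `ms = [m₁, m₂, …]`. -/
def gapWord (m : ℕ) (ms : List ℕ) : List Bool :=
  ms.foldl (fun w m => List.replicate m false ++ true :: w) (List.replicate m false)

theorem gapWord_concat (m : ℕ) (ms : List ℕ) (l : ℕ) :
    gapWord m (ms ++ [l]) = List.replicate l false ++ true :: gapWord m ms := by
  simp [gapWord]

theorem count_true_gapWord (m : ℕ) (ms : List ℕ) : (gapWord m ms).count true = ms.length := by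
  induction ms using List.reverseRecOn with
  | nil => simp [gapWord, List.count_replicate]
  | append_singleton ms l ih => simp [gapWord_concat, List.count_replicate, ih]

theorem length_gapWord (m : ℕ) (ms : List ℕ) :
    (gapWord m ms).length = m + ms.sum + ms.length := by
  induction ms using List.reverseRecOn with
  | nil => simp [gapWord]
  | append_singleton ms l ih => simp [gapWord_concat, ih]; omega

theorem exists_eq_gapWord (w : List Bool) : ∃ m ms, w = gapWord m ms := by
  induction w with
  | nil => exact ⟨0, [], rfl⟩
  | cons b w ih =>
    obtain ⟨m, ms, rfl⟩ := ih
    cases b with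
    | true => exact ⟨m, ms ++ [0], by simp [gapWord_concat]⟩
    | false =>
      rcases ms.eq_nil_or_concat with rfl | ⟨ms, l, rfl⟩
      · exact ⟨m + 1, [], rfl⟩
      · exact ⟨m, ms ++ [l + 1], by simp [gapWord_concat, List.replicate_succ]⟩

theorem count_true_ofFn {n : ℕ} (a : Fin n → Bool) :
    (List.ofFn a).count true = (Finset.univ.filter fun i => a i = true).card := by
  induction n with
  | zero => simp
  | succ n ih =>
    rw [List.ofFn_succ, List.count_cons, ih, Finset.card_filter, Finset.card_filter,
      Fin.sum_univ_succ, add_comm]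
    simp

end ParamComplexity

namespace HDG

/-! ### Games with one agent who approves or disapproves of coalitions -/

theorem card_filter_color_eq_of_palette_eq {n γ : ℕ} {color : Fin n → Fin γ}
    {X Y : Finset (Fin n)} (h : palette color X = palette color Y) {c : Fin γ}
    (hc : (X.filter fun a => color a = c).card = (Y.filter fun a => color a = c).card)
    (hX : (X.filter fun a => color a = c).Nonempty) (c' : Fin γ) :
    (X.filter fun a => color a = c').card = (Y.filter fun a => color a = c').card := by
  have hX₀ : (X.card : ℚ) ≠ 0 := by
    exact_mod_cast (hX.mono (Finset.filter_subset ..)).card_pos.ne'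
  have hc₀ : ((Y.filter fun a => color a = c).card : ℚ) ≠ 0 := by
    exact_mod_cast hc ▸ hX.card_pos.ne'
  have card_eq : (X.card : ℚ) = Y.card := by
    have := congrFun h c
    rwa [palette, palette, hc, div_eq_mul_inv, div_eq_mul_inv, mul_right_inj' hc₀, inv_inj] at this
  have := congrFun h c'
  rw [palette, palette, ← card_eq, div_left_inj' hX₀] at this
  exact_mod_cast this

variable {m N : ℕ}

/-- The agents of a game with `m` blocks of `N` agents and the additional agent `0`. -/
abbrev Agent (m N : ℕ) : Type := Fin (m * N + 1)

/-- The `j`-th agent of the block `c`. -/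
def agentAt (c : Fin m) (j : Fin N) : Agent m N := (finProdFinEquiv (c, j)).succ

/-- The additional agent has colour `0`, the agents of the block `c` have colour `c + 1`. -/
def blockColor : Agent m N → Fin (m + 1) :=
  Fin.cons 0 fun i => (finProdFinEquiv.symm i).1.succ

/-- The number of members of a coalition in a block. -/
def blockCount (X : Finset (Agent m N)) (c : Fin m) : ℕ :=
  (Finset.univ.filter fun j => agentAt c j ∈ X).card

theorem blockColor_zero : blockColor (0 : Agent m N) = 0 := rfl

theorem blockColor_agentAt (c : Fin m) (j : Fin N) : blockColor (agentAt c j) = c.succ := by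
  rw [blockColor, agentAt, Fin.cons_succ, Equiv.symm_apply_apply]

theorem agentAt_injective : Function.Injective2 (agentAt : Fin m → Fin N → Agent m N) := by
  intro c c' j j' h
  simpa [agentAt] using h

theorem eq_zero_or_exists_eq_agentAt (i : Agent m N) : i = 0 ∨ ∃ c j, i = agentAt c j := by
  induction i using Fin.cases with
  | zero => exact .inl rfl
  | succ i => exact .inr ⟨_, _, congrArg Fin.succ (finProdFinEquiv.apply_symm_apply i).symm⟩

theorem blockColor_surjective [NeZero N] :
    Function.Surjective (blockColor : Agent m N → Fin (m + 1)) := by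
  intro c
  induction c using Fin.cases with
  | zero => exact ⟨0, blockColor_zero⟩
  | succ c => exact ⟨agentAt c 0, blockColor_agentAt c 0⟩

theorem card_filter_blockColor_zero (X : Finset (Agent m N)) :
    (X.filter fun i => blockColor i = 0).card = if 0 ∈ X then 1 else 0 := by
  have : (X.filter fun i => blockColor i = 0) = X.filter (· = 0) := by
    refine Finset.filter_congr fun i _ => ⟨fun h => ?_, fun h => h ▸ blockColor_zero⟩
    obtain rfl | ⟨c, j, rfl⟩ := eq_zero_or_exists_eq_agentAt i
    · rfl
    · exact absurd (blockColor_agentAt c j ▸ h) (Fin.succ_ne_zero c)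
  rw [this, Finset.filter_eq']
  split_ifs <;> rfl

theorem card_filter_blockColor_succ (X : Finset (Agent m N)) (c : Fin m) :
    (X.filter fun i => blockColor i = c.succ).card = blockCount X c := by
  rw [blockCount, ← Finset.card_map ⟨agentAt (N := N) c, agentAt_injective.right c⟩]
  refine congrArg Finset.card (Finset.ext fun i => ?_)
  simp only [Finset.mem_filter, Finset.mem_map, Finset.mem_univ, true_and,
    Function.Embedding.coeFn_mk]
  constructor
  · rintro ⟨hi, hc⟩
    obtain rfl | ⟨c', j, rfl⟩ := eq_zero_or_exists_eq_agentAt i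
    · exact absurd hc (Fin.succ_ne_zero c).symm
    · obtain rfl := Fin.succ_injective _ (blockColor_agentAt c' j ▸ hc)
      exact ⟨j, hi, rfl⟩
  · rintro ⟨j, hj, rfl⟩
    exact ⟨hj, blockColor_agentAt c j⟩

theorem card_eq_sum_blockCount (X : Finset (Agent m N)) :
    X.card = (if 0 ∈ X then 1 else 0) + ∑ c, blockCount X c := by
  rw [Finset.card_eq_sum_card_fiberwise (f := blockColor) (t := Finset.univ) (by simp),
    Fin.sum_univ_succ, card_filter_blockColor_zero]
  simp only [card_filter_blockColor_succ]

theorem exists_blockCount_eq {f : Fin m → ℕ} (hf : ∀ c, f c ≤ N) :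
    ∃ X : Finset (Agent m N), 0 ∈ X ∧ blockCount X = f := by
  refine ⟨Finset.univ.filter fun i => ∀ c j, i = agentAt c j → (j : ℕ) < f c, ?_, ?_⟩
  · simp only [Finset.mem_filter, Finset.mem_univ, true_and]
    exact fun c j h => absurd h.symm (Fin.succ_ne_zero _)
  · funext c
    have mem_iff (j : Fin N) :
        (∀ c' j', agentAt c j = agentAt c' j' → (j' : ℕ) < f c') ↔ (j : ℕ) < f c := by
      refine ⟨fun h => h c j rfl, fun h c' j' e => ?_⟩
      obtain ⟨rfl, rfl⟩ := agentAt_injective e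
      exact h
    simp only [blockCount, Finset.mem_filter, Finset.mem_univ, true_and, mem_iff]
    rw [Fin.card_filter_val_lt, min_eq_right (hf c)]

variable (A : (Fin m → ℕ) → Prop)

/-- The coalitions that the additional agent approves of: it is alone or the numbers of the other
members in the blocks satisfy `A`. -/
def Approved (X : Finset (Agent m N)) : Prop :=
  0 ∈ X ∧ (blockCount X = 0 ∨ A (blockCount X))

theorem approved_singleton_zero : Approved A ({0} : Finset (Agent m N)) :=
  ⟨Finset.mem_singleton_self 0, .inl (by ext; simp [blockCount, agentAt])⟩

/-- The palettes of approved coalitions. -/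
def ApprovedPalette (p : Palette (blockColor (m := m) (N := N))) : Prop :=
  ∃ (X : Finset (Agent m N)) (hX : X.Nonempty), Palette.of blockColor X hX = p ∧ Approved A X

theorem approvedPalette_of_iff {X : Finset (Agent m N)} (hX : X.Nonempty) :
    ApprovedPalette A (Palette.of blockColor X hX) ↔ Approved A X := by
  refine ⟨fun ⟨Y, hY, h, mem, hA⟩ => ?_, fun h => ⟨X, hX, rfl, h⟩⟩
  have h := congrArg Subtype.val h
  have card_zero : (Y.filter fun i => blockColor i = 0).card = 1 := by
    rw [card_filter_blockColor_zero, if_pos mem]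
  have mem_iff : 0 ∈ X := by
    by_contra hmem
    have := congrFun h 0
    simp only [Palette.of, palette, card_zero, card_filter_blockColor_zero, if_neg hmem] at this
    simp [hY.ne_empty] at this
  have count_eq : blockCount Y = blockCount X := by
    funext c
    rw [← card_filter_blockColor_succ, ← card_filter_blockColor_succ]
    refine card_filter_color_eq_of_palette_eq h (c := 0) ?_ ?_ c.succ
    · rw [card_zero, card_filter_blockColor_zero, if_pos mem_iff]
    · exact Finset.card_pos.1 (by rw [card_zero]; exact Nat.one_pos)
  exact ⟨mem_iff, count_eq ▸ hA⟩

/-- The game in which the additional agent prefers the approved palettes to all others and all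
other agents are indifferent. Its bounds allow two coalitions, of which neither contains all
agents nor all but one. -/
def approvalGame [NeZero N] (A : (Fin m → ℕ) → Prop) : Instance where
  n := m * N + 1
  n_pos := Nat.succ_pos _
  γ := m + 1
  color := blockColor (N := N)
  color_surjective := blockColor_surjective
  pref i p q := i = 0 → ApprovedPalette A q → ApprovedPalette A p
  pref_total i p q := by tauto
  pref_trans i p q r h₁ h₂ hi := h₁ hi ∘ h₂ hi
  maxSize := m * N - 1
  maxCoalitions := 2
  maxNontrivial := 2

variable [NeZero N] {A}

theorem weakPref_approvalGame_iff {i : Agent m N} {X Y : Finset (Agent m N)} (hX : X.Nonempty)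
    (hY : Y.Nonempty) :
    (approvalGame A).WeakPref i X Y ↔ (i = 0 → Approved A Y → Approved A X) := by
  rw [← approvedPalette_of_iff A hX, ← approvedPalette_of_iff A hY]
  exact ⟨fun ⟨_, _, h⟩ => h, fun h => ⟨hX, hY, h⟩⟩

theorem numTypes_approvalGame [NeZero m] : (approvalGame (N := N) A).numTypes = 2 := by
  let P (p q : Palette (blockColor (m := m) (N := N))) : Prop :=
    ApprovedPalette A q → ApprovedPalette A p
  have pref_zero : (approvalGame A).pref (0 : Agent m N) = P := by
    funext p q
    exact propext ⟨fun h => h rfl, fun h _ => h⟩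
  have pref_agentAt (c j) : (approvalGame A).pref (agentAt c j : Agent m N) = fun _ _ => True := by
    funext p q
    exact eq_true fun h => absurd h (Fin.succ_ne_zero _)
  have range_pref : Set.range (approvalGame (N := N) A).pref =
      ({P, fun _ _ => True} : Set (Palette blockColor → Palette blockColor → Prop)) := by
    refine Set.Subset.antisymm ?_ (Set.pair_subset ⟨_, pref_zero⟩ ⟨_, pref_agentAt 0 0⟩)
    rintro _ ⟨i, rfl⟩
    obtain rfl | ⟨c, j, rfl⟩ := eq_zero_or_exists_eq_agentAt i
    · exact .inl pref_zero
    · exact .inr (pref_agentAt c j)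
  refine (congrArg Set.ncard range_pref).trans (Set.ncard_pair fun h => ?_)
  have zero_le := (congrFun₂ h (Palette.of blockColor {agentAt 0 0} (Finset.singleton_nonempty _))
    (Palette.of blockColor {0} (Finset.singleton_nonempty _))).mpr trivial
  simp only [P, approvedPalette_of_iff] at zero_le
  exact Fin.succ_ne_zero _ (Finset.mem_singleton.1 (zero_le (approved_singleton_zero A)).1).symm

theorem approved_of_individuallyStable {P : Finpartition (Finset.univ : Finset (Agent m N))}
    (hP : Instance.IndividuallyStable (G := approvalGame A) P) : Approved A (P.part 0) := by
  by_contra h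
  have part_nonempty : (P.part 0).Nonempty := ⟨0, P.mem_part (Finset.mem_univ _)⟩
  refine hP (0 : Agent m N) ∅ ⟨⟨.inr rfl, ?_, ?_⟩, by simp⟩
  · exact (weakPref_approvalGame_iff (Finset.insert_nonempty ..) part_nonempty).2
      fun _ h' => absurd h' h
  · intro h'
    exact h ((weakPref_approvalGame_iff part_nonempty (Finset.insert_nonempty ..)).1 h' rfl
      (approved_singleton_zero A))

theorem blockCount_part_zero_ne_zero [NeZero m]
    {P : Finpartition (Finset.univ : Finset (Agent m N))}
    (hP : Instance.Admissible (G := approvalGame A) P) : blockCount (P.part 0) ≠ 0 := by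
  intro h
  have mem_parts : P.part 0 ∈ P.parts := P.part_mem.2 (Finset.mem_univ _)
  have card_part : (P.part 0).card = 1 := by
    rw [card_eq_sum_blockCount (P.part 0), h, if_pos (P.mem_part (Finset.mem_univ _))]
    simp
  have card_rest : ∑ C ∈ P.parts.erase (P.part 0), C.card ≤ m * N - 1 :=
    calc ∑ C ∈ P.parts.erase (P.part 0), C.card
      _ ≤ (P.parts.erase (P.part 0)).card • (m * N - 1) :=
        Finset.sum_le_card_nsmul _ _ _ fun C hC => hP.2.2 C (Finset.mem_of_mem_erase hC)
      _ ≤ 1 * (m * N - 1) := by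
        refine Nat.mul_le_mul_right _ ?_
        rw [Finset.card_erase_of_mem mem_parts]
        exact Nat.sub_le_of_le_add hP.1
      _ = m * N - 1 := one_mul _
  have card_agents : (P.part 0).card + ∑ C ∈ P.parts.erase (P.part 0), C.card = m * N + 1 := by
    rw [Finset.add_sum_erase _ _ mem_parts, P.sum_card_parts]
    exact Finset.card_fin _
  have := Nat.mul_pos (NeZero.pos m) (NeZero.pos N)
  omega

theorem exists_nashStable_of_approved {X : Finset (Agent m N)} (hX : Approved A X)
    (two_le : 2 ≤ X.card) (card_le : X.card ≤ m * N - 1) :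
    ∃ P : (approvalGame (N := N) A).Outcome, Instance.Admissible P ∧ Instance.NashStable P := by
  have card_compl : X.card + Xᶜ.card = m * N + 1 := by
    rw [Finset.card_add_card_compl, Fintype.card_fin]
  have hX₀ : X ≠ ⊥ := by rintro rfl; simp at two_le
  have hXc : Xᶜ ≠ ⊥ := by intro h; simp [h] at card_compl; omega
  let P : Finpartition (Finset.univ : Finset (Agent m N)) :=
    (Finpartition.indiscrete hXc).extend hX₀ disjoint_compl_left
      (by rw [sup_comm]; exact sup_compl_eq_top)
  have parts_eq : P.parts = {X, Xᶜ} := rfl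
  have card_parts : P.parts.card ≤ 2 := parts_eq ▸ Finset.card_le_two
  have part_zero : P.part 0 = X := P.part_eq_of_mem (by simp [parts_eq]) hX.1
  have card_le_of_mem (C : Finset (Agent m N)) (hC : C ∈ P.parts) : C.card ≤ m * N - 1 := by
    rw [parts_eq, Finset.mem_insert, Finset.mem_singleton] at hC
    obtain rfl | rfl := hC
    · exact card_le
    · omega
  refine ⟨P, ⟨card_parts, (Finset.card_filter_le _ _).trans card_parts, card_le_of_mem⟩, ?_⟩
  rintro i C ⟨-, ⟨⟨_, part_nonempty, -⟩, hlt⟩⟩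
  refine hlt ((weakPref_approvalGame_iff part_nonempty (Finset.insert_nonempty ..)).2 ?_)
  rintro rfl -
  exact part_zero ▸ hX

theorem approvalGame_mem_yes_iff [NeZero m] {stable : ∀ G : Instance, G.Outcome → Prop}
    (of_nash : ∀ G P, Instance.NashStable P → stable G P)
    (to_individual : ∀ G P, stable G P → Instance.IndividuallyStable P) :
    approvalGame (N := N) A ∈ (problem stable).yes ↔
      ∃ f, A f ∧ f ≠ 0 ∧ (∀ c, f c ≤ N) ∧ ∑ c, f c + 2 ≤ m * N := by
  constructor
  · rintro ⟨P : Finpartition (Finset.univ : Finset (Agent m N)), admissible, hP⟩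
    obtain ⟨mem, hA⟩ := approved_of_individuallyStable (to_individual _ P hP)
    have ne_zero := blockCount_part_zero_ne_zero admissible
    refine ⟨_, hA.resolve_left ne_zero, ne_zero, fun c => ?_, ?_⟩
    · exact (Finset.card_filter_le _ _).trans_eq (Finset.card_fin N)
    · have card_le : (P.part 0).card ≤ m * N - 1 :=
        admissible.2.2 _ (P.part_mem.2 (Finset.mem_univ _))
      rw [card_eq_sum_blockCount (P.part 0), if_pos mem] at card_le
      have := Nat.mul_pos (NeZero.pos m) (NeZero.pos N)
      omega
  · rintro ⟨f, hA, ne_zero, hf, sum_le⟩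
    obtain ⟨X, mem, rfl⟩ := exists_blockCount_eq hf
    have card_eq := card_eq_sum_blockCount X
    rw [if_pos mem] at card_eq
    have sum_pos : ∑ c, blockCount X c ≠ 0 := fun h =>
      ne_zero (funext fun c => Finset.sum_eq_zero_iff.1 h c (Finset.mem_univ c))
    obtain ⟨P, admissible, hP⟩ := exists_nashStable_of_approved (A := A) ⟨mem, .inr hA⟩
      (by omega) (by omega)
    exact ⟨P, admissible, of_nash _ P hP⟩

end HDG

namespace ParamComplexity

/-! ### Weighted 2-CNF-Satisfiability in terms of words of gaps -/

theorem mem_weightedTwoCNFSat_iff {x : List Bool} {k : ℕ} :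
    (x, k) ∈ weightedTwoCNFSat ↔ ∃ w, Evaluates x w ∧ w.count true = k := by
  simp only [weightedTwoCNFSat, Set.mem_ofPred_eq, evaluates_iff]
  constructor
  · rintro ⟨φ, hx, a, sat, hk⟩
    exact ⟨_, ⟨φ, a, hx, sat, rfl⟩, by simp [← hk, count_true_ofFn]⟩
  · rintro ⟨_, ⟨φ, a, hx, sat, rfl⟩, hk⟩
    exact ⟨φ, hx, a, sat, by simpa [count_true_ofFn] using hk⟩

theorem Evaluates.count_true_lt_length {x w : List Bool} (h : Evaluates x w) :
    w.count true < w.length := by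
  obtain ⟨φ, a, -, -, rfl⟩ := evaluates_iff.1 h
  simpa [Nat.lt_succ_iff] using List.count_le_length (a := true) (l := List.ofFn a)

theorem Evaluates.length_le {x w : List Bool} (h : Evaluates x w) : w.length ≤ x.length := by
  obtain ⟨φ, a, rfl, -, rfl⟩ := evaluates_iff.1 h
  simp only [TwoCNF.encode, encNat, Machine.unary, List.length_append, List.length_replicate,
    List.length_singleton, List.length_ofFn]
  omega

/-- The word of gaps `f` encodes a satisfying assignment of the formula `x`. There are `k + 1`
gaps, so the assignment has weight `k`. -/
def SatisfyingGaps (x : List Bool) {k : ℕ} (f : Fin (k + 1) → ℕ) : Prop :=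
  Evaluates x (gapWord (f 0) (List.ofFn fun i : Fin k => f i.succ))

theorem SatisfyingGaps.sum_pos_and_le {x : List Bool} {k : ℕ} {f : Fin (k + 1) → ℕ}
    (h : SatisfyingGaps x f) : 0 < ∑ c, f c ∧ ∑ c, f c ≤ x.length := by
  have lt_length := Evaluates.count_true_lt_length h
  have length_le := Evaluates.length_le h
  rw [length_gapWord, List.sum_ofFn, List.length_ofFn] at lt_length length_le
  rw [count_true_gapWord, List.length_ofFn] at lt_length
  rw [Fin.sum_univ_succ]
  omega

theorem exists_evaluates_iff_exists_satisfyingGaps {x : List Bool} {k : ℕ} :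
    (∃ w, Evaluates x w ∧ w.count true = k) ↔ ∃ f : Fin (k + 1) → ℕ, SatisfyingGaps x f := by
  constructor
  · rintro ⟨w, hw, hk⟩
    obtain ⟨m, ms, rfl⟩ := exists_eq_gapWord w
    rw [count_true_gapWord] at hk
    subst hk
    exact ⟨Fin.cons m ms.get, by simpa [SatisfyingGaps] using hw⟩
  · rintro ⟨f, hf⟩
    exact ⟨_, hf, by rw [count_true_gapWord, List.length_ofFn]⟩

end ParamComplexity

namespace HDG

open Machine ParamComplexity

/-! ### The game of a formula -/

/-- The game whose approved coalitions encode the satisfying assignments of weight `k` of the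
formula `x`. The blocks are large enough for all assignments. -/
def formulaGame (x : List Bool) (k : ℕ) : Instance :=
  approvalGame (m := k + 1) (N := x.length + 2) (SatisfyingGaps x)

theorem mem_weightedTwoCNFSat_iff_formulaGame_mem_yes {stable : ∀ G : Instance, G.Outcome → Prop}
    (of_nash : ∀ G P, Instance.NashStable P → stable G P)
    (to_individual : ∀ G P, stable G P → Instance.IndividuallyStable P) (x : List Bool) (k : ℕ) :
    (x, k) ∈ weightedTwoCNFSat ↔ formulaGame x k ∈ (problem stable).yes := by
  rw [mem_weightedTwoCNFSat_iff, exists_evaluates_iff_exists_satisfyingGaps, formulaGame,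
    approvalGame_mem_yes_iff of_nash to_individual]
  refine exists_congr fun f => ⟨fun hf => ?_, And.left⟩
  obtain ⟨sum_pos, sum_le⟩ := hf.sum_pos_and_le
  refine ⟨hf, ?_, fun c => ?_, by nlinarith⟩
  · rintro rfl
    simp at sum_pos
  · have := Finset.single_le_sum (f := f) (fun _ _ => Nat.zero_le _) (Finset.mem_univ c)
    omega

/-! ### Computing the explicit part of the game of a formula -/

theorem ofFn_agent {m N : ℕ} {α : Type*} (f : Agent m N → α) :
    List.ofFn f = f 0 :: (List.ofFn fun c => List.ofFn fun j => f (agentAt c j)).flatten := by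
  rw [List.ofFn_succ, List.ofFn_mul]
  have index_eq (c : Fin m) (j : Fin N) (h) : (⟨c * N + j, h⟩ : Fin (m * N)).succ = agentAt c j :=
    Fin.ext (by simp [agentAt, mul_comm, add_comm])
  simp only [index_eq]

theorem encode_approvalGame {m N : ℕ} [NeZero N] (A : (Fin m → ℕ) → Prop) :
    (approvalGame (N := N) A).encode =
      encNat (m + 1) ++ (encNat (m * N - 1) ++ (encNat 2 ++ (encNat 2 ++ (encNat 0 ++
        (List.ofFn fun c : Fin m => (List.replicate N (encNat (c + 1))).flatten).flatten)))) := by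
  change encNat _ ++ encNat _ ++ encNat _ ++ encNat _ ++
    (List.ofFn fun i : Agent m N => encNat (blockColor i)).flatten = _
  simp only [ofFn_agent, blockColor_zero, blockColor_agentAt, List.ofFn_const, List.append_assoc,
    List.flatten_cons, List.flatten_flatten, List.map_ofFn]
  rfl

/-- Push the code of the number on stack `1` on stack `0`. -/
def emitNumber : Prog := .seq (.push 0 false) <| .seq (moveBoth 1 0 3) (move 3 1)

theorem runs_emitNumber (n : ℕ) (o l : List Bool) (s : Store) :
    Runs emitNumber (o ∷ unary n ∷ l ∷ [] ∷ s) ((encNat n ++ o) ∷ unary n ∷ l ∷ [] ∷ s)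
      (10 * n + 3) := by
  have copy := runs_moveBoth (a := 1) (b := 0) (c := 3) (by omega) (by omega) (by omega)
    ((false :: o) ∷ unary n ∷ l ∷ [] ∷ s)
  have restore := runs_move (a := 3) (b := 1) (by omega)
    (((unary n).reverse ++ false :: o) ∷ [] ∷ l ∷ ((unary n).reverse ++ []) ∷ s)
  refine (((Runs.push _ 0 false).seq (copy.seq restore)).mono ?_).congr ?_
  · simp [Store.cons, unary]
    omega
  · simp [Store.cons, Store.set, unary, encNat]

/-- Push the code of the number on stack `1` on stack `0` once for each symbol on stack `2`, and
count the repetitions on stack `4`. -/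
def emitBlock : Prog :=
  .seq (.loop 2 (.seq emitNumber <| .seq (moveTop 2 6) (.push 4 true))) (move 6 2)

theorem runs_emitBlock_loop (n : ℕ) (o l t u v : List Bool) (s : Store) :
    Runs (.loop 2 (.seq emitNumber <| .seq (moveTop 2 6) (.push 4 true)))
      (o ∷ unary n ∷ l ∷ [] ∷ t ∷ u ∷ v ∷ s)
      (((List.replicate l.length (encNat n)).flatten ++ o) ∷ unary n ∷ [] ∷ [] ∷
        (unary l.length ++ t) ∷ u ∷ (l.reverse ++ v) ∷ s) (l.length * (10 * n + 8) + 1) := by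
  induction l generalizing o t v with
  | nil => exact (Runs.loopNil rfl).mono (by simp)
  | cons b l ih =>
    have body := (runs_emitNumber n o (b :: l) (t ∷ u ∷ v ∷ s)).seq <|
      (runs_moveTop (a := 2) (b := 6) (by omega) rfl).seq (.push _ 4 true)
    refine ((Runs.loopCons rfl body (ih (encNat n ++ o) (true :: t) (b :: v))).mono ?_).congr ?_
    · rw [List.length_cons]
      linarith
    · simp [unary, List.replicate_succ']

theorem runs_emitBlock (n : ℕ) (o l t u : List Bool) (s : Store) :
    Runs emitBlock (o ∷ unary n ∷ l ∷ [] ∷ t ∷ u ∷ [] ∷ s)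
      (((List.replicate l.length (encNat n)).flatten ++ o) ∷ unary n ∷ l ∷ [] ∷
        (unary l.length ++ t) ∷ u ∷ [] ∷ s) (l.length * (10 * n + 12) + 2) := by
  have restore := runs_move (a := 6) (b := 2) (by omega)
    (((List.replicate l.length (encNat n)).flatten ++ o) ∷ unary n ∷ [] ∷ [] ∷
        (unary l.length ++ t) ∷ u ∷ (l.reverse ++ []) ∷ s)
  refine (((runs_emitBlock_loop n o l t u [] s).seq restore).mono ?_).congr ?_
  · simp [Store.cons]
    linarith
  · simp [Store.cons, Store.set]

/-- Push the codes of the colours of all blocks on stack `0`, where the number of blocks is on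
stack `1`, and is moved to stack `5`. -/
def emitBlocks : Prog := .loop 1 (.seq emitBlock (moveTop 1 5))

theorem runs_emitBlocks {m M : ℕ} (hm : m ≤ M) (o l t u : List Bool) (s : Store) :
    Runs emitBlocks (o ∷ unary m ∷ l ∷ [] ∷ t ∷ u ∷ [] ∷ s)
      (((List.ofFn fun c : Fin m => (List.replicate l.length (encNat (c + 1))).flatten).flatten
          ++ o) ∷ [] ∷ l ∷ [] ∷ (unary (m * l.length) ++ t) ∷ (unary m ++ u) ∷ [] ∷ s)
      (m * (l.length * (10 * M + 12) + 6) + 1) := by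
  induction m generalizing o t u with
  | zero => exact ((Runs.loopNil rfl).mono (by simp)).congr (by simp [unary])
  | succ m ih =>
    have body := (runs_emitBlock (m + 1) o l t u s).seq
      (runs_moveTop (a := 1) (b := 5) (by omega) rfl)
    have loop := ih (by omega) ((List.replicate l.length (encNat (m + 1))).flatten ++ o)
      (unary l.length ++ t) (true :: u)
    refine ((Runs.loopCons rfl body loop).mono ?_).congr ?_
    · have : l.length * (10 * (m + 1) + 12) ≤ l.length * (10 * M + 12) := by gcongr
      linarith
    · rw [List.ofFn_succ', List.concat_eq_append]
      simp [unary, add_one_mul, ← List.replicate_append_replicate]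

/-- From the number of agents other than `0` on stack `4` and the number of blocks on stack `5`,
push the codes of the number of colours, of the bounds of the game and of the colour of agent `0`
on stack `0`, and write the parameter on stack `1`. -/
def emitBounds : Prog :=
  .seq (pushWord 0 (encNat 2 ++ (encNat 2 ++ encNat 0))) <|
  .seq (.pop 4) <| .seq (.push 0 false) <| .seq (move 4 0) <|
  .seq (.push 0 false) <| .seq (.push 5 true) <| .seq (moveBoth 5 0 1) (pushWord 1 (unary 4))

theorem runs_emitBounds (m M : ℕ) (o l : List Bool) (s : Store) :
    Runs emitBounds (o ∷ [] ∷ l ∷ [] ∷ unary M ∷ unary m ∷ s)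
      ((encNat (m + 1) ++ (encNat (M - 1) ++ (encNat 2 ++ (encNat 2 ++ (encNat 0 ++ o))))) ∷
        unary (m + 5) ∷ l ∷ [] ∷ [] ∷ [] ∷ s) (4 * M + 6 * m + 30) := by
  have start := runs_pushWord 0 (encNat 2 ++ (encNat 2 ++ encNat 0))
    (o ∷ [] ∷ l ∷ [] ∷ unary M ∷ unary m ∷ s)
  refine ((start.seq <| (Runs.pop _ 4).seq <| (Runs.push _ 0 false).seq <|
    (runs_move (by omega) _).seq <| (Runs.push _ 0 false).seq <| (Runs.push _ 5 true).seq <|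
    (runs_moveBoth (by omega) (by omega) (by omega) _).seq <|
    runs_pushWord 1 (unary 4) _).mono ?_).congr ?_
  · simp [Store.cons, Store.set, unary, encNat]
    omega
  · have reverse_unary (j : ℕ) : (unary j).reverse = unary j := List.reverse_replicate
    have unary_param : unary 4 ++ unary (m + 1) = unary (m + 5) := by
      rw [unary, unary, List.replicate_append_replicate, add_comm, unary]
    change ((unary (m + 1)).reverse ++ false :: ((unary M).tail.reverse ++ false ::
      (encNat 2 ++ (encNat 2 ++ encNat 0) ++ o))) ∷ (unary 4 ++ ((unary (m + 1)).reverse ++ [])) ∷ _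
        = _
    rw [reverse_unary, List.append_nil, unary_param, show (unary M).tail = unary (M - 1) from
      List.tail_replicate, reverse_unary]
    simp only [encNat, List.append_assoc, List.singleton_append]
    rfl

/-- From `x` on stack `0` and `k` on stack `1`, compute the explicit part of `formulaGame x k` on
stack `0` and its parameter on stack `1`. -/
def inputProg : Prog :=
  .seq (.seq (move 0 2) <| .seq (pushWord 2 (unary 2)) (.push 1 true)) <|
  .seq emitBlocks emitBounds

theorem runs_inputProg (x : List Bool) (k : ℕ) :
    ∃ s, Runs inputProg (initStore x (unary k) []) s (200 * (k + 1) ^ 2 * (x.length + 1)) ∧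
      s 0 = (formulaGame x k).encode ∧ s 1 = unary (k + 6) := by
  let l : List Bool := true :: true :: (x.reverse ++ [])
  have length_l : l.length = x.length + 2 := by simp [l]
  have start : initStore x (unary k) [] = x ∷ unary k ∷ [] ∷ [] ∷ [] ∷ [] ∷ [] ∷ Store.empty := by
    simp only [initStore_eq, Store.nil_cons_empty]
  have prepare : Runs (.seq (move 0 2) <| .seq (pushWord 2 (unary 2)) (.push 1 true))
      (initStore x (unary k) []) ([] ∷ unary (k + 1) ∷ l ∷ [] ∷ [] ∷ [] ∷ [] ∷ Store.empty)
      (4 * x.length + 5) := by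
    rw [start]
    exact (runs_move (by omega) _).seq <| (runs_pushWord 2 (unary 2) _).seq <| Runs.push _ 1 true
  have colors := (runs_emitBlocks (le_refl (k + 1)) [] l [] [] Store.empty).congr
    (by rw [List.append_nil, List.append_nil, List.append_nil])
  refine ⟨_, (prepare.seq <| colors.seq <|
      (runs_emitBounds (k + 1) ((k + 1) * l.length) _ l ([] ∷ Store.empty))).mono ?_, ?_, rfl⟩
  · have : k + 1 ≤ (k + 1) ^ 2 := Nat.le_self_pow two_ne_zero _
    have : (k + 1) * (x.length + 1) ≤ (k + 1) ^ 2 * (x.length + 1) := Nat.mul_le_mul_right _ this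
    rw [length_l]
    nlinarith
  · rw [formulaGame, encode_approvalGame]
    simp [Store.cons, length_l]

end HDG

namespace ParamComplexity

open Machine

/-! ### Evaluating a formula on a machine -/

/-- The word that represents a mode on a stack. -/
def EvalMode.code : EvalMode → List Bool
  | header => []
  | sign => [false]
  | var c => [true, c]
  | failed => [true]

/-- The memory that represents an evaluation state on the first four stacks. -/
def EvalState.store (σ : EvalState) (s : Store) : Store :=
  σ.rest ∷ σ.done ∷ σ.mode.code ∷ σ.pending.toList ∷ s

/-- The number of values of the assignment in a state. -/
def EvalState.size (σ : EvalState) : ℕ := σ.rest.length + σ.done.length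

/-- Read the symbol `1` of a formula. -/
def stepOne : Prog :=
  let advance := moveTop 0 1
  .branch 2 advance (.seq (.pop 2) <| .seq (.push 2 true) (.push 2 true)) <|
    .seq (.pop 2) <| .branch 2 (.push 2 true) (.seq (.push 2 true) advance)
      (.seq (.push 2 true) advance)

/-- Write the mode and the pending value after a literal with value `v`. -/
def recordValue (v : Bool) : Prog :=
  .branch 3 (.seq (.push 3 v) (.push 2 false)) (.seq (.pop 3) (.push 2 !v))
    (.seq (.pop 3) (.push 2 false))

/-- Move the head past the value of a literal and record that the literal has value `v`, unless the
head arrives at the end of the word. -/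
def passValue (v : Bool) : Prog :=
  .seq (moveTop 0 1) (.branch 0 (.push 2 true) (recordValue v) (recordValue v))

/-- At the end of the code of a literal with sign `c`, evaluate it and move the head back to the
first value. -/
def evalLiteral (c : Bool) : Prog :=
  .seq (.pop 2) <|
    .seq (.branch 0 (.push 2 true) (passValue (false == c)) (passValue (true == c))) (move 1 0)

/-- At the end of the code of the number of variables, compare it with the number of values and
move the head back to the first value. -/
def checkLength : Prog :=
  .seq (.branch 0 (.push 2 true)
    (.seq (moveTop 0 1) (.branch 0 (.push 2 false) (.push 2 true) (.push 2 true)))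
    (.push 2 true)) (move 1 0)

/-- Read the symbol `0` of a formula. -/
def stepZero : Prog :=
  .branch 2 checkLength (.push 2 true) <|
    .seq (.pop 2) <| .branch 2 (.push 2 true) (evalLiteral false) (evalLiteral true)

theorem runs_advance (σ : EvalState) (s : Store) :
    Runs (moveTop 0 1) (σ.store s) (σ.advance.store s) 3 := by
  obtain ⟨_ | ⟨b, r⟩, d, m, p⟩ := σ
  · exact (Runs.branchEmpty rfl .skip).seq (.pop _ 0)
  · exact runs_moveTop (by omega) rfl

theorem runs_stepOne (σ : EvalState) (s : Store) :
    Runs stepOne (σ.store s) ((σ.step true).store s) 7 := by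
  obtain ⟨r, d, _ | _ | c | _, p⟩ := σ
  · exact (Runs.branchEmpty rfl (runs_advance ⟨r, d, .header, p⟩ s)).mono (by omega)
  · exact (Runs.branchZero rfl ((Runs.pop _ 2).seq
      ((Runs.push _ 2 true).seq (.push _ 2 true)))).mono (by omega)
  · have advance := (Runs.push (r ∷ d ∷ [c] ∷ p.toList ∷ s) 2 true).seq
      (runs_advance ⟨r, d, .var c, p⟩ s)
    refine (Runs.branchOne rfl ((Runs.pop _ 2).seq (T₂ := 5) ?_)).mono (by omega)
    cases c
    · exact .branchZero rfl advance
    · exact .branchOne rfl advance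
  · exact (Runs.branchOne rfl ((Runs.pop _ 2).seq (.branchEmpty rfl (.push _ 2 true)))).mono
      (by omega)

theorem runs_recordValue (r d w : List Bool) (p : Option Bool) (v : Bool) (s : Store) :
    Runs (recordValue v) (r ∷ d ∷ [] ∷ p.toList ∷ s)
      (r ∷ d ∷ (EvalState.record w p v).mode.code ∷ (EvalState.record w p v).pending.toList ∷ s)
      3 := by
  match p, v with
  | none, _ => exact .branchEmpty rfl ((Runs.push _ 3 _).seq (.push _ 2 false))
  | some false, false | some false, true =>
    exact .branchZero rfl ((Runs.pop _ 3).seq (.push _ 2 _))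
  | some true, _ => exact .branchOne rfl ((Runs.pop _ 3).seq (.push _ 2 false))

theorem runs_rewind (r d m p : List Bool) (s : Store) :
    Runs (move 1 0) (r ∷ d ∷ m ∷ p ∷ s) ((d.reverse ++ r) ∷ [] ∷ m ∷ p ∷ s)
      (4 * d.length + 1) :=
  runs_move (by omega) _

theorem runs_moveTop_zero_one (b : Bool) (r d : List Bool) (s : Store) :
    Runs (moveTop 0 1) ((b :: r) ∷ d ∷ s) (r ∷ (b :: d) ∷ s) 3 :=
  runs_moveTop Nat.zero_ne_one rfl

theorem EvalState.record_rest_done (w : List Bool) (p : Option Bool) (v : Bool) :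
    (record w p v).rest = w ∧ (record w p v).done = [] := by
  unfold record
  split
  · exact ⟨rfl, rfl⟩
  · split_ifs <;> exact ⟨rfl, rfl⟩

theorem runs_evalLiteral (r d : List Bool) (c : Bool) (p : Option Bool) (s : Store) :
    Runs (evalLiteral c) (r ∷ d ∷ [c] ∷ p.toList ∷ s)
      ((EvalState.step ⟨r, d, .var c, p⟩ false).store s) (4 * d.length + 14) := by
  cases r with
  | nil =>
    exact ((Runs.pop _ 2).seq ((Runs.branchEmpty rfl (.push _ 2 true)).seq
      (runs_rewind _ d _ _ s))).mono (by omega)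
  | cons b r =>
    let τ (r : List Bool) := EvalState.step ⟨b :: r, d, .var c, p⟩ false
    have pass : Runs (passValue (b == c)) ((b :: r) ∷ d ∷ [] ∷ p.toList ∷ s)
        (r ∷ (b :: d) ∷ (τ r).mode.code ∷ (τ r).pending.toList ∷ s) 7 := by
      refine (runs_moveTop_zero_one b r d _).seq (T₂ := 4) ?_
      match r with
      | [] => exact (Runs.branchEmpty rfl (.push ([] ∷ (b :: d) ∷ [] ∷ _) 2 true)).mono (by omega)
      | false :: r => exact .branchZero rfl (runs_recordValue _ _ _ p (b == c) s)
      | true :: r => exact .branchOne rfl (runs_recordValue _ _ _ p (b == c) s)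
    have select : Runs (.branch 0 (.push 2 true) (passValue (false == c)) (passValue (true == c)))
        ((b :: r) ∷ d ∷ [] ∷ p.toList ∷ s)
        (r ∷ (b :: d) ∷ (τ r).mode.code ∷ (τ r).pending.toList ∷ s) 8 := by
      cases b
      · exact .branchZero rfl pass
      · exact .branchOne rfl pass
    have rewound : (τ r).rest = (b :: d).reverse ++ r ∧ (τ r).done = [] := by
      match r with
      | [] => simp [τ, EvalState.step, EvalState.error]
      | b' :: r => simp [τ, EvalState.step, EvalState.record_rest_done]
    refine (((Runs.pop _ 2).seq (select.seq (runs_rewind _ (b :: d) _ _ s))).mono ?_).congr ?_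
    · rw [List.length_cons]; omega
    · rw [EvalState.store, rewound.1, rewound.2]

theorem runs_checkLength (r d : List Bool) (p : Option Bool) (s : Store) :
    Runs checkLength (r ∷ d ∷ [] ∷ p.toList ∷ s)
      ((EvalState.step ⟨r, d, .header, p⟩ false).store s) (4 * d.length + 12) := by
  match r with
  | [] =>
    exact ((Runs.branchEmpty rfl (.push _ 2 true)).seq (runs_rewind _ d _ _ s)).mono (by omega)
  | true :: r =>
    exact ((Runs.branchOne rfl (.push _ 2 true)).seq (runs_rewind _ d _ _ s)).mono (by omega)
  | false :: r =>
    let τ (r : List Bool) := EvalState.step ⟨false :: r, d, .header, p⟩ false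
    have test : Runs (.seq (moveTop 0 1) (.branch 0 (.push 2 false) (.push 2 true) (.push 2 true)))
        ((false :: r) ∷ d ∷ [] ∷ p.toList ∷ s) (r ∷ (false :: d) ∷ (τ r).mode.code ∷ p.toList ∷ s)
        5 := by
      refine (runs_moveTop_zero_one false r d _).seq (T₂ := 2) ?_
      match r with
      | [] => exact .branchEmpty rfl (.push _ 2 false)
      | false :: r => exact .branchZero rfl (.push _ 2 true)
      | true :: r => exact .branchOne rfl (.push _ 2 true)
    have rewound : (τ r).store s
        = ((false :: d).reverse ++ r) ∷ [] ∷ (τ r).mode.code ∷ p.toList ∷ s := by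
      cases r <;> simp [τ, EvalState.step, EvalState.between, EvalState.error, EvalState.store]
    refine (((Runs.branchZero rfl test).seq (runs_rewind _ (false :: d) _ _ s)).mono ?_).congr
      rewound.symm
    rw [List.length_cons]
    omega

theorem runs_stepZero (σ : EvalState) (s : Store) :
    Runs stepZero (σ.store s) ((σ.step false).store s) (4 * σ.done.length + 17) := by
  obtain ⟨r, d, _ | _ | c | _, p⟩ := σ
  · exact (Runs.branchEmpty rfl (runs_checkLength r d p s)).mono (by dsimp only; omega)
  · exact (Runs.branchZero rfl (.push _ 2 true)).mono (by omega)
  · refine (Runs.branchOne rfl ((Runs.pop _ 2).seq (T₂ := 4 * d.length + 15) ?_)).mono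
      (by dsimp only; omega)
    cases c
    · exact .branchZero rfl (runs_evalLiteral r d false p s)
    · exact .branchOne rfl (runs_evalLiteral r d true p s)
  · exact (Runs.branchOne rfl ((Runs.pop _ 2).seq (.branchEmpty rfl (.push _ 2 true)))).mono
      (by omega)

theorem EvalState.size_step (σ : EvalState) (b : Bool) : (σ.step b).size = σ.size := by
  have size_advance (σ : EvalState) : σ.advance.size = σ.size := by
    obtain ⟨_ | ⟨b, r⟩, d, m, p⟩ := σ
    · rfl
    · simp only [advance, size, List.length_cons]
      omega
  unfold step
  split
  case h_1 | h_5 => exact size_advance _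
  all_goals simp [size, between, error, record_rest_done]
  all_goals omega

/-! ### Answering a query on a machine -/

/-- Move the top of stack `0`, a symbol of a formula, to stack `4` and read it in the evaluation
state on the stacks `5` to `8`. -/
def readSymbol : Prog :=
  .seq (.branch 0 .skip (stepZero.shift 5) (stepOne.shift 5)) (moveTop 0 4)

/-- Read the formula on stack `0` in the evaluation state on the stacks `5` to `8`. -/
def readFormula : Prog := .seq (.loop 0 readSymbol) (move 4 0)

theorem runs_readSymbol (b : Bool) (x k q res t : List Bool) (σ : EvalState) (s : Store) :
    Runs readSymbol ((b :: x) ∷ k ∷ q ∷ res ∷ t ∷ σ.store s)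
      (x ∷ k ∷ q ∷ res ∷ (b :: t) ∷ (σ.step b).store s) (4 * σ.size + 21) := by
  have select : Runs (.branch 0 .skip (stepZero.shift 5) (stepOne.shift 5))
      ((b :: x) ∷ k ∷ q ∷ res ∷ t ∷ σ.store s)
      ((b :: x) ∷ k ∷ q ∷ res ∷ t ∷ (σ.step b).store s) (4 * σ.done.length + 18) := by
    cases b
    · exact .branchZero rfl ((runs_stepZero σ s).shift [false :: x, k, q, res, t])
    · exact (Runs.branchOne rfl ((runs_stepOne σ s).shift [true :: x, k, q, res, t])).mono
        (by omega)
  exact (select.seq (runs_moveTop (by omega) rfl)).mono (by rw [EvalState.size]; omega)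

theorem runs_loop_readSymbol (x k q res t : List Bool) (σ : EvalState) (s : Store) :
    Runs (.loop 0 readSymbol) (x ∷ k ∷ q ∷ res ∷ t ∷ σ.store s)
      ([] ∷ k ∷ q ∷ res ∷ (x.reverse ++ t) ∷ (x.foldl EvalState.step σ).store s)
      (x.length * (4 * σ.size + 22) + 1) := by
  induction x generalizing t σ with
  | nil => exact (Runs.loopNil rfl).mono (by simp)
  | cons b x ih =>
    have rest := ih (b :: t) (σ.step b)
    rw [EvalState.size_step] at rest
    refine ((Runs.loopCons rfl (runs_readSymbol b x k q res t σ s) rest).mono ?_).congr ?_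
    · rw [List.length_cons]
      linarith
    · simp

theorem runs_restoreFormula (x k q res : List Bool) (s : Store) :
    Runs (move 4 0) ([] ∷ k ∷ q ∷ res ∷ (x.reverse ++ []) ∷ s) (x ∷ k ∷ q ∷ res ∷ [] ∷ s)
      (4 * x.length + 1) := by
  refine ((runs_move (by omega) _).mono ?_).congr ?_ <;> simp [Store.cons, Store.set]

theorem runs_readFormula (x k q res : List Bool) (σ : EvalState) (s : Store) :
    Runs readFormula (x ∷ k ∷ q ∷ res ∷ [] ∷ σ.store s)
      (x ∷ k ∷ q ∷ res ∷ [] ∷ (x.foldl EvalState.step σ).store s)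
      (x.length * (4 * σ.size + 26) + 2) :=
  ((runs_loop_readSymbol x k q res [] σ s).seq (runs_restoreFormula ..)).mono (by linarith)

/-- Move the top of stack `0` to stack `4`, pop a symbol of the query on stack `2`, and if that is
`1`, push `0` on stack `5` and a mark on stack `10`. -/
def readBit : Prog :=
  .seq (moveTop 0 4) <|
    .seq (.branch 2 .skip .skip (.seq (.push 5 false) (.push 10 true))) (.pop 2)

/-- Read as many symbols of the query as there are symbols on stack `0`. -/
def readBlock : Prog := .seq (.loop 0 readBit) (move 4 0)

section ReadBlock

variable {x bs : List Bool} (k q res w d m p g marks : List Bool) (s : Store)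

theorem runs_readBit (b c : Bool) (x t : List Bool) :
    Runs readBit ((b :: x) ∷ k ∷ (c :: q) ∷ res ∷ t ∷ w ∷ d ∷ m ∷ p ∷ g ∷ marks ∷ s)
      (x ∷ k ∷ q ∷ res ∷ (b :: t) ∷ (List.replicate ([c].count true) false ++ w) ∷ d ∷ m ∷ p ∷ g ∷
        (unary ([c].count true) ++ marks) ∷ s) 7 := by
  refine (runs_moveTop (by omega) rfl).seq (T₂ := 4) ?_
  cases c
  · exact ((Runs.branchZero rfl .skip).seq (.pop _ 2)).mono (by omega)
  · exact (Runs.branchOne rfl ((Runs.push _ 5 false).seq (.push _ 10 true))).seq (.pop _ 2)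

theorem runs_loop_readBit (h : bs.length = x.length) (t : List Bool) :
    Runs (.loop 0 readBit) (x ∷ k ∷ (bs ++ q) ∷ res ∷ t ∷ w ∷ d ∷ m ∷ p ∷ g ∷ marks ∷ s)
      ([] ∷ k ∷ q ∷ res ∷ (x.reverse ++ t) ∷ (List.replicate (bs.count true) false ++ w) ∷ d ∷ m ∷
        p ∷ g ∷ (unary (bs.count true) ++ marks) ∷ s) (8 * x.length + 1) := by
  induction x generalizing bs t w marks with
  | nil =>
    obtain rfl := List.length_eq_zero_iff.1 h
    exact .loopNil rfl
  | cons b x ih =>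
    obtain ⟨c, bs, rfl⟩ := List.exists_cons_of_length_eq_add_one h
    refine ((Runs.loopCons rfl (runs_readBit k (bs ++ q) res w d m p g marks s b c x t)
      (ih (bs := bs) _ _ (by simpa using h) (b :: t))).mono ?_).congr ?_
    · rw [List.length_cons]
      omega
    · have count_cons : (c :: bs).count true = bs.count true + [c].count true :=
        List.count_append (l₁ := [c]) .. |>.trans (add_comm ..)
      simp [unary, count_cons, ← List.replicate_append_replicate]

theorem runs_readBlock (h : bs.length = x.length) :
    Runs readBlock (x ∷ k ∷ (bs ++ q) ∷ res ∷ [] ∷ w ∷ d ∷ m ∷ p ∷ g ∷ marks ∷ s)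
      (x ∷ k ∷ q ∷ res ∷ [] ∷ (List.replicate (bs.count true) false ++ w) ∷ d ∷ m ∷ p ∷ g ∷
        (unary (bs.count true) ++ marks) ∷ s) (12 * x.length + 2) :=
  ((runs_loop_readBit k q res w d m p g marks s h []).seq (runs_restoreFormula ..)).mono (by omega)

end ReadBlock

/-- Read one block of the query for each symbol on stack `1`, after pushing `1` on stack `5` as a
separator, and move that symbol to stack `6`. -/
def readBlocks : Prog := .loop 1 (.seq (moveTop 1 6) <| .seq (.push 5 true) readBlock)

theorem runs_readBlocks {x : List Bool} {bss : List (List Bool)}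
    (h : ∀ bs ∈ bss, bs.length = x.length) (q res w d m p g marks : List Bool) (s : Store) :
    Runs readBlocks
      (x ∷ unary bss.length ∷ (bss.flatten ++ q) ∷ res ∷ [] ∷ w ∷ d ∷ m ∷ p ∷ g ∷ marks ∷ s)
      (x ∷ [] ∷ q ∷ res ∷ [] ∷
        (bss.map (List.count true)).foldl (fun w m => List.replicate m false ++ true :: w) w ∷
        (unary bss.length ++ d) ∷ m ∷ p ∷ g ∷
        (unary (bss.map (List.count true)).sum ++ marks) ∷ s)
      (bss.length * (12 * x.length + 7) + 1) := by
  induction bss generalizing w d marks with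
  | nil => exact (Runs.loopNil rfl).mono (by simp)
  | cons bs bss ih =>
    obtain ⟨hbs, hbss⟩ := List.forall_mem_cons.1 h
    have body := (runs_moveTop (a := 1) (b := 6) (by omega) (c := true) (w := unary bss.length)
        (s := x ∷ unary (bss.length + 1) ∷ (bs ++ (bss.flatten ++ q)) ∷ res ∷ [] ∷ w ∷ d ∷ m ∷ p ∷
          g ∷ marks ∷ s) rfl).seq <| (Runs.push _ 5 true).seq <|
      runs_readBlock (x := x) (unary bss.length) (bss.flatten ++ q) res (true :: w) (true :: d) m p
        g marks s hbs
    have rest := ih hbss (List.replicate (bs.count true) false ++ true :: w) (true :: d)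
      (unary (bs.count true) ++ marks)
    rw [List.flatten_cons, List.append_assoc]
    refine ((Runs.loopCons rfl body rest).mono ?_).congr ?_
    · rw [List.length_cons]
      linarith
    · have swap (i j : ℕ) (u : List Bool) : unary i ++ (unary j ++ u) = unary (j + i) ++ u := by
        rw [← List.append_assoc, unary, unary, List.replicate_append_replicate, add_comm, unary]
      have swap_cons : unary bss.length ++ true :: d = unary (bss.length + 1) ++ d :=
        (swap bss.length 1 d).trans (by rw [add_comm])
      simp only [List.map_cons, List.foldl_cons, List.sum_cons, List.length_cons, swap, swap_cons]

/-- Push on stack `3` whether the bit on stack `9` is `1` and either stack `10` is empty or the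
evaluation state on the stacks `5` to `8` is between two clauses. -/
def writeVerdict : Prog :=
  let write (b : Bool) : Prog := .push 3 b
  let verdict : Prog := .branch 7 (write false)
    (.branch 8 (write true) (write false) (write false)) (write false)
  .branch 9 (write false) (write false) (.branch 10 (write true) verdict verdict)

theorem runs_writeVerdict (x k q res marks : List Bool) (σ : EvalState) (g : Bool) (s : Store) :
    ∃ b : Bool,
      (b = true ↔ g = true ∧ (marks = [] ∨ σ.mode = .sign ∧ σ.pending = none)) ∧
      Runs writeVerdict (x ∷ k ∷ q ∷ res ∷ [] ∷ σ.store ([g] ∷ marks ∷ s))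
        (x ∷ k ∷ q ∷ (b :: res) ∷ [] ∷ σ.store ([g] ∷ marks ∷ s)) 5 := by
  let final (b : Bool) : Store := x ∷ k ∷ q ∷ (b :: res) ∷ [] ∷ σ.store ([g] ∷ marks ∷ s)
  have write (b : Bool) {T : ℕ} (hT : 1 ≤ T) :
      Runs (.push 3 b) (x ∷ k ∷ q ∷ res ∷ [] ∷ σ.store ([g] ∷ marks ∷ s)) (final b) T :=
    (Runs.push _ 3 b).mono hT
  obtain ⟨r, d, mode, p⟩ := σ
  cases g with
  | false => exact ⟨false, by simp, .branchZero rfl (write false (by omega))⟩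
  | true =>
    cases marks with
    | nil => exact ⟨true, by simp, .branchOne rfl (.branchEmpty rfl (write true (by omega)))⟩
    | cons c marks =>
      suffices h : ∃ b : Bool, (b = true ↔ mode = .sign ∧ p = none) ∧
          Runs (.branch 7 (.push 3 false) (.branch 8 (.push 3 true) (.push 3 false) (.push 3 false))
            (.push 3 false)) (x ∷ k ∷ q ∷ res ∷ [] ∷ EvalState.store ⟨r, d, mode, p⟩
              ([true] ∷ (c :: marks) ∷ s)) (final b) 3 by
        obtain ⟨b, hb, h⟩ := h
        refine ⟨b, by simpa using hb, .branchOne rfl ?_⟩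
        cases c
        · exact .branchZero rfl h
        · exact .branchOne rfl h
      match mode, p with
      | .header, _ => exact ⟨false, by simp, .branchEmpty rfl (write false (by omega))⟩
      | .sign, none => exact ⟨true, by simp, .branchZero rfl (.branchEmpty rfl (write true le_rfl))⟩
      | .sign, some false =>
        exact ⟨false, by simp, .branchZero rfl (.branchZero rfl (write false le_rfl))⟩
      | .sign, some true =>
        exact ⟨false, by simp, .branchZero rfl (.branchOne rfl (write false le_rfl))⟩
      | .var _, _ | .failed, _ =>
        exact ⟨false, by simp, .branchOne rfl (write false (by omega))⟩

/-- Read a coalition from the query on stack `2`, and push on stack `3` whether it is approved in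
`formulaGame x k`, where `x` is the word on stack `0` and `k` the length of stack `1`. -/
def judge : Prog :=
  .seq (.seq (moveTop 2 9) <| .seq (.push 0 true) (.push 0 true)) <|
  .seq (.seq readBlock <| .seq readBlocks (move 6 1)) <|
  .seq (.seq (.pop 0) (.pop 0)) <|
  .seq readFormula <| .seq writeVerdict ((clears 6).shift 5)

section Judge

variable {x bs : List Bool} {bss : List (List Bool)} (q res : List Bool) (s : Store)

theorem runs_readGapWord (hbs : bs.length = x.length) (hbss : ∀ b ∈ bss, b.length = x.length)
    (g : Bool) :
    Runs (.seq readBlock <| .seq readBlocks (move 6 1))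
      (x ∷ unary bss.length ∷ (bs ++ (bss.flatten ++ q)) ∷ res ∷ [] ∷ [] ∷ [] ∷ [] ∷ [] ∷ [g] ∷ [] ∷
        s)
      (x ∷ unary bss.length ∷ q ∷ res ∷ [] ∷
        gapWord (bs.count true) (bss.map (List.count true)) ∷ [] ∷ [] ∷ [] ∷ [g] ∷
        unary (bs.count true + (bss.map (List.count true)).sum) ∷ s)
      (12 * x.length + bss.length * (12 * x.length + 11) + 4) := by
  have first := runs_readBlock (unary bss.length) (bss.flatten ++ q) res [] [] [] [] [g] [] s hbs
  have others := runs_readBlocks hbss q res (List.replicate (bs.count true) false ++ []) [] [] []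
    [g] (unary (bs.count true) ++ []) s
  refine ((first.seq <| others.seq <| runs_move (a := 6) (b := 1) (by omega) _).mono ?_).congr ?_
  · simp [Store.cons, unary]
    linarith
  · simp only [Store.cons, Store.set, gapWord, unary, add_comm, List.append_nil,
      List.reverse_replicate, List.replicate_append_replicate]
    rfl

theorem runs_clearWindow (x k q res w₀ w₁ w₂ w₃ w₄ w₅ : List Bool) :
    Runs ((clears 6).shift 5)
      (x ∷ k ∷ q ∷ res ∷ [] ∷ w₀ ∷ w₁ ∷ w₂ ∷ w₃ ∷ w₄ ∷ w₅ ∷ s)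
      (x ∷ k ∷ q ∷ res ∷ [] ∷ [] ∷ [] ∷ [] ∷ [] ∷ [] ∷ [] ∷ s)
      (2 * (w₀.length + w₁.length + w₂.length + w₃.length + w₄.length + w₅.length) + 7) :=
  ((runs_clears [w₀, w₁, w₂, w₃, w₄, w₅] s).shift [x, k, q, res, []]).mono
    (by simp; omega)

theorem EvalState.size_foldl_step (x : List Bool) (σ : EvalState) :
    (x.foldl step σ).size = σ.size := by
  induction x generalizing σ with
  | nil => rfl
  | cons b x ih => exact (ih _).trans (σ.size_step b)

theorem EvalState.length_code_le (mode : EvalMode) : mode.code.length ≤ 2 := by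
  cases mode <;> simp [EvalMode.code]

theorem runs_judgeGapWord (x k q res w : List Bool) (g : Bool) (n : ℕ) :
    ∃ b : Bool, (b = true ↔ g = true ∧ (n = 0 ∨ Evaluates x w)) ∧
      Runs (.seq readFormula <| .seq writeVerdict ((clears 6).shift 5))
        (x ∷ k ∷ q ∷ res ∷ [] ∷ w ∷ [] ∷ [] ∷ [] ∷ [g] ∷ unary n ∷ s)
        (x ∷ k ∷ q ∷ (b :: res) ∷ [] ∷ [] ∷ [] ∷ [] ∷ [] ∷ [] ∷ [] ∷ s)
        (x.length * (4 * w.length + 26) + 2 * w.length + 2 * n + 22) := by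
  let σ : EvalState := ⟨w, [], .header, none⟩
  let τ : EvalState := x.foldl EvalState.step σ
  obtain ⟨b, hb, verdict⟩ := runs_writeVerdict x k q res (unary n) τ g s
  refine ⟨b, hb.trans (by rw [unary, List.replicate_eq_nil_iff]; rfl), ?_⟩
  have size_τ : τ.rest.length + τ.done.length = w.length := EvalState.size_foldl_step x σ
  have mode_τ := EvalState.length_code_le τ.mode
  have pending_τ : τ.pending.toList.length ≤ 1 := by cases τ.pending <;> simp
  refine ((runs_readFormula x k q res σ _).seq <| verdict.seq <|
    runs_clearWindow s x k q (b :: res) τ.rest τ.done τ.mode.code τ.pending.toList [g]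
      (unary n)).mono ?_
  simp only [σ, EvalState.size, unary, List.length_replicate, List.length_nil,
    List.length_singleton, add_zero]
  omega

theorem judgeTime_le {l k n : ℕ} (hn : n ≤ (k + 1) * (l + 2)) :
    3 + (1 + 1) + (12 * (l + 1 + 1) + k * (12 * (l + 1 + 1) + 11) + 4 +
      (1 + 1 + (l * (4 * (n + k) + 26) + 2 * (n + k) + 2 * n + 22))) ≤
        50 * (k + 1) * (l + 3) ^ 2 := by
  have length_le : n + k ≤ (k + 1) * (l + 3) := by linarith
  have read_le : l * (4 * (n + k) + 26) ≤ l * (4 * ((k + 1) * (l + 3)) + 26) := by gcongr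
  nlinarith

theorem runs_judge (hbs : bs.length = x.length + 2) (hbss : ∀ b ∈ bss, b.length = x.length + 2)
    (g : Bool) :
    ∃ b : Bool,
      (b = true ↔ g = true ∧ (bs.count true + (bss.map (List.count true)).sum = 0 ∨
        Evaluates x (gapWord (bs.count true) (bss.map (List.count true))))) ∧
      Runs judge (x ∷ unary bss.length ∷ (g :: bs ++ (bss.flatten ++ q)) ∷ res ∷ Store.empty)
        (x ∷ unary bss.length ∷ q ∷ (b :: res) ∷ Store.empty)
        (50 * (bss.length + 1) * (x.length + 3) ^ 2) := by
  let m := bs.count true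
  let ms := bss.map (List.count true)
  obtain ⟨b, hb, verdict⟩ := runs_judgeGapWord Store.empty x (unary bss.length) q res
    (gapWord m ms) g (m + ms.sum)
  have m_le : m ≤ x.length + 2 := List.count_le_length.trans_eq hbs
  have sum_le : ms.sum ≤ bss.length * (x.length + 2) := by
    refine (List.sum_le_card_nsmul ms (x.length + 2) ?_).trans_eq (by simp [ms])
    simp only [ms, List.mem_map]
    rintro _ ⟨b, hb, rfl⟩
    exact List.count_le_length.trans_eq (hbss b hb)
  have empty_eq : Store.empty = [] ∷ [] ∷ [] ∷ [] ∷ [] ∷ [] ∷ [] ∷ Store.empty := by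
    simp only [Store.nil_cons_empty]
  refine ⟨b, hb, ?_⟩
  rw [empty_eq]
  have start := (runs_moveTop (a := 2) (b := 9) (by omega) (c := g)
    (w := bs ++ (bss.flatten ++ q)) (s := x ∷ unary bss.length ∷ (g :: bs ++ (bss.flatten ++ q)) ∷
      res ∷ [] ∷ [] ∷ [] ∷ [] ∷ [] ∷ [] ∷ [] ∷ Store.empty) rfl).seq <|
    (Runs.push _ 0 true).seq (.push _ 0 true)
  refine (start.seq <| (runs_readGapWord (x := true :: true :: x) q res Store.empty hbs hbss g).seq
    <| ((Runs.pop _ 0).seq (.pop _ 0)).seq verdict).mono ?_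
  rw [length_gapWord, show ms.length = bss.length from List.length_map _, List.length_cons,
    List.length_cons]
  exact judgeTime_le (by linarith)

end Judge

end ParamComplexity

namespace HDG

open Machine ParamComplexity

theorem runs_judge_coalition {x : List Bool} {k : ℕ} (X : Finset (Agent (k + 1) (x.length + 2)))
    (q res : List Bool) :
    ∃ b : Bool, (b = true ↔ Approved (SatisfyingGaps x) X) ∧
      Runs judge
        (x ∷ unary k ∷ ((List.ofFn fun i => decide (i ∈ X)) ++ q) ∷ res ∷ Store.empty)
        (x ∷ unary k ∷ q ∷ (b :: res) ∷ Store.empty) (50 * (k + 1) * (x.length + 3) ^ 2) := by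
  let block (c : Fin (k + 1)) : List Bool := List.ofFn fun j => decide (agentAt c j ∈ X)
  have count_block (c) : (block c).count true = blockCount X c := by
    rw [count_true_ofFn]
    simp only [decide_eq_true_eq, blockCount]
  have map_count : (List.ofFn fun c : Fin k => block c.succ).map (List.count true)
      = List.ofFn fun c : Fin k => blockCount X c.succ := by
    rw [List.map_ofFn]
    exact congrArg List.ofFn (funext fun c => count_block c.succ)
  obtain ⟨b, hb, h⟩ := runs_judge (bs := block 0) (bss := List.ofFn fun c : Fin k => block c.succ)
    q res (List.length_ofFn ..) (by simp [block]) (decide (0 ∈ X))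
  rw [count_block, map_count, List.sum_ofFn, ← Fin.sum_univ_succ, decide_eq_true_eq] at hb
  have sum_eq_zero : ∑ c, blockCount X c = 0 ↔ blockCount X = 0 := by
    simp [Finset.sum_eq_zero_iff, funext_iff]
  refine ⟨b, hb.trans (by rw [sum_eq_zero]; rfl), ?_⟩
  rw [ofFn_agent, List.ofFn_succ (f := fun c => List.ofFn _), List.flatten_cons]
  simp only [List.length_ofFn, List.cons_append, List.append_assoc] at h ⊢
  exact h

/-- Write the answer on stack `0`: it is negative if the top of stack `3`, the verdict on the second
coalition, is `1` and the verdict on the first coalition, below it, is `0`. -/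
def writeAnswer : Prog :=
  .seq (clears 1) (.branch 3 .skip (.push 0 true) (.seq (.pop 3) (moveTop 3 0)))

theorem runs_writeAnswer (x k q : List Bool) (b c : Bool) (s : Store) :
    ∃ s', Runs writeAnswer (x ∷ k ∷ q ∷ [c, b] ∷ s) s' (2 * x.length + 7) ∧ s' 0 = [!c || b] := by
  have clear := runs_clears [x] (k ∷ q ∷ [c, b] ∷ s)
  cases c
  · exact ⟨_, (clear.seq (.branchZero rfl (.push _ 0 true))).mono (by simp), rfl⟩
  · exact ⟨_, (clear.seq (.branchOne rfl
      ((Runs.pop _ 3).seq (runs_moveTop (by omega) rfl)))).mono (by simp), rfl⟩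

/-- Answer a query to `formulaGame x k`, which is on stack `2`, with `x` on stack `0` and `k` on
stack `1`. -/
def oracleProg : Prog :=
  .branch 2 .skip (.seq (.pop 2) <| .seq judge <| .seq judge writeAnswer)
    (.seq (clears 1) (.push 0 true))

theorem runs_oracleProg (x : List Bool) (k : ℕ) (q : (formulaGame x k).Query) :
    ∃ (s : Store) (b : Bool),
      Runs oracleProg (initStore x (unary k) ((formulaGame x k).encodeQuery q)) s
        (110 * (k + 1) * (x.length + 3) ^ 2) ∧
      s 0 = [b] ∧ (b = true ↔ (formulaGame x k).WeakPref q.agent q.left q.right) := by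
  obtain ⟨i, X, Y, hX, hY⟩ := q
  change Agent (k + 1) (x.length + 2) at i
  change Finset (Agent (k + 1) (x.length + 2)) at X Y
  let word (Z : Finset (Agent (k + 1) (x.length + 2))) : List Bool :=
    List.ofFn fun i => decide (i ∈ Z)
  have start : initStore x (unary k) ((formulaGame x k).encodeQuery ⟨i, X, Y, hX, hY⟩)
      = x ∷ unary k ∷ (encNat i ++ word X ++ word Y) ∷ [] ∷ Store.empty := by
    rw [initStore_eq, Store.nil_cons_empty]
    rfl
  simp only [formulaGame, weakPref_approvalGame_iff hX hY] at start ⊢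
  rw [start]
  have length_le : x.length + 3 ≤ (k + 1) * (x.length + 3) ^ 2 := by nlinarith
  induction i using Fin.cases with
  | zero =>
    obtain ⟨b, hb, judge_left⟩ := runs_judge_coalition X (word Y ++ []) []
    obtain ⟨c, hc, judge_right⟩ := runs_judge_coalition Y [] [b]
    obtain ⟨s, answer, hs⟩ := runs_writeAnswer x (unary k) [] b c Store.empty
    refine ⟨s, !c || b, ?_, hs, ?_⟩
    · rw [List.append_nil] at judge_left judge_right
      exact (Runs.branchZero rfl ((Runs.pop _ 2).seq
        (judge_left.seq (judge_right.seq answer)))).mono (by linarith)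
    · rw [← hb, ← hc]
      cases b <;> cases c <;> simp
  | succ i =>
    refine ⟨_, true, (Runs.branchOne rfl ((runs_clears [x] _).seq (.push _ 0 true))).mono ?_, rfl,
      iff_of_true rfl fun h => absurd h (Fin.succ_ne_zero i)⟩
    simp only [List.map_cons, List.map_nil, List.sum_singleton, List.length_singleton]
    linarith

/-! ### Hardness -/

theorem param_formulaGame (stable : ∀ G : Instance, G.Outcome → Prop) (x : List Bool) (k : ℕ) :
    (problem stable).param (formulaGame x k) = k + 6 :=
  congrArg (k + 1 + 1 + 2 + ·) numTypes_approvalGame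

theorem oracleFPTComputable_formulaGame (stable : ∀ G : Instance, G.Outcome → Prop) :
    OracleFPTComputable (problem stable) formulaGame := by
  constructor
  · refine ⟨inputProg, fun k => 200 * (k + 1) ^ 2, 1, ?_, fun x k => ?_⟩
    · exact Primrec.nat_mul.to_comp.comp (Computable.const 200)
        (computable_pow_const Primrec.succ.to_comp 2)
    · obtain ⟨s, ⟨t, ht, h⟩, hs₀, hs₁⟩ := runs_inputProg x k
      exact ⟨s, t, h, hs₀, hs₁.trans (congrArg unary (param_formulaGame stable x k).symm),
        by rwa [pow_one]⟩
  · refine ⟨oracleProg, fun k => 990 * (k + 1), 2,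
      Primrec.nat_mul.to_comp.comp (Computable.const 990) Primrec.succ.to_comp, fun x k q => ?_⟩
    obtain ⟨s, b, ⟨t, ht, h⟩, hs, hb⟩ := runs_oracleProg x k q
    refine ⟨s, t, b, h, hs, hb, ht.trans ?_⟩
    calc 110 * (k + 1) * (x.length + 3) ^ 2
      _ ≤ 110 * (k + 1) * (3 * (x.length + ((formulaGame x k).encodeQuery q).length + 1)) ^ 2 := by
        gcongr
        omega
      _ = 990 * (k + 1) * (x.length + ((formulaGame x k).encodeQuery q).length + 1) ^ 2 := by
        ring

end HDG

theorem mainTheorem5_general {stable : ∀ G : HDG.Instance, G.Outcome → Prop}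
    (of_nash : ∀ G P, HDG.Instance.NashStable P → stable G P)
    (to_individual : ∀ G P, stable G P → HDG.Instance.IndividuallyStable P) :
    ParamComplexity.W1Hard (HDG.problem stable) :=
  ParamComplexity.w1Hard_of_reducesToOracle
    ⟨HDG.formulaGame, HDG.oracleFPTComputable_formulaGame stable,
      ⟨fun k => k + 6, Primrec.nat_add.to_comp.comp Computable.id (Computable.const 6),
        fun x k => (HDG.param_formulaGame stable x k).le⟩,
      HDG.mem_weightedTwoCNFSat_iff_formulaGame_mem_yes of_nash to_individual⟩

theorem mainTheorem5 :
    ParamComplexity.W1Hard HDG.nash ∧ ParamComplexity.W1Hard HDG.individual :=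
  ⟨mainTheorem5_general (fun _ _ h => h) fun _ _ h i C hC => h i C hC.1,
    mainTheorem5_general (fun _ _ h i C hC => h i C hC.1) fun _ _ h => h⟩
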